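/- Setting. Let $1\le k\le\infty$, let $E$ and $M$ be finite-dimensional Hausdorff manifolds (without boundary) of class $C^{k+1}$, and let $\pi:E\to M$ be a $C^{k+1}$ submersion (for instance the projection of a differentiable bundle). A path in $M$ is a $C^1$ map $\gamma:J\to M$ on a nonempty interval $J\subseteq\mathbb R$ of any kind; velocities at end-points are one-sided. A *connection* is a $C^k$ distribution $H\subset TE$ of rank $\dim M$ with $H_p\oplus\ker d\pi_p=T_pE$ for all $p\in E$. A *horizontal lift* of $\gamma:J\to M$ is a $C^1$ path $c:J\to E$ with $\pi\circ c=\gamma$ and $\dot c(t)\in H_{c(t)}$ for all $t\in J$. The connection is *complete* if every path $\gamma:J\to M$ has, for all $s\in J$ and $p\in\pi^{-1}(\gamma(s))$, a horizontal lift $c:J\to E$ with $c(s)=p$. A *transport along paths* $I$ assigns to each path $\gamma:J\to M$ and all $s,t\in J$ a map $I^\gamma_{s\to t}:\pi^{-1}(\gamma(s))\to\pi^{-1}(\gamma(t))$ such that $I^\gamma_{s\to s}=\mathrm{id}$ and $I^\gamma_{s\to t}\circ I^\gamma_{r\to s}=I^\gamma_{r\to t}$. The lift of $\gamma$ through $p\in\pi^{-1}(\gamma(s))$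 is $t\mapsto I^\gamma_{s\to t}(p)$. Let $\Delta^I_p\subseteq T_pE$ be the set of velocities at $p$ of the lifts through $p$ of all paths (on intervals with more than one point) passing through $\pi(p)$. Call $I$ *regular* if 1. $I^{\gamma|J'}_{s\to t}=I^\gamma_{s\to t}$ for every nonempty interval $J'\subseteq J$ and $s,t\in J'$; 2. $I^{\gamma\circ\chi}_{s\to t}=I^\gamma_{\chi(s)\to\chi(t)}$ for every $C^1$ diffeomorphism of intervals $\chi:J'\to J$ of either orientation; 3. lifts of $C^1$ paths are $C^1$; 4. the velocity at $p$ of the lift through $p$ depends only on $p$ and the velocity of the path at $\pi(p)$; 5. for every $C^k$ vector field $X$ on an open $U\subseteq M$, the vector field on $\pi^{-1}(U)$ assigning to $p$ the velocity at $p$ of the lifts through $p$ of paths with velocity $X(\pi(p))$ is $C^k$. A *parallel transport* $P$ assigns to each $C^1$ path $\gamma:[a,b]\to M$, $a\le b$, a map $P^\gamma:\pi^{-1}(\gamma(a))\to\pi^{-1}(\gamma(b))$ such that 1. $P^\gamma=\mathrm{id}$ if $a=b$; 2. $P^{\gamma}=P^{\gamma|[b,c]}\circ P^{\gamma|[a,b]}$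 for $\gamma:[a,c]\to M$ and $a\le b\le c$; 3. $P^{\gamma^-}=(P^{\gamma})^{-1}$ for the inverse path $\gamma^-(t)=\gamma(a+b-t)$; 4. $P^{\gamma\circ\chi}=P^\gamma$ for every orientation preserving $C^1$ diffeomorphism $\chi$ of compact intervals; 5. the lifts $t\mapsto P^{\gamma|[a,t]}(p)$ are $C^1$; 6. the initial velocity of a lift from $p$ depends only on $p$ and the initial velocity of the path; 7. for every $C^k$ vector field $X$ on an open $U\subseteq M$, the vector field on $\pi^{-1}(U)$ assigning to $p$ the initial velocity of the lifts from $p$ of paths with initial velocity $X(\pi(p))$ is $C^k$. Let $\Delta^P_p\subseteq T_pE$ be the set of all initial velocities of lifts from $p$ (of paths on intervals $[a,b]$, $a<b$). Theorem. (a) If $I$ is a regular transport along paths, then every $\Delta^I_p$ is a linear subspace of $T_pE$ and $\Delta^I$ is a connection. (b) $I\mapsto\Delta^I$ is a bijection from the regular transports along paths onto the complete connections. For a connection $H$, a transport along paths $I$ is regular with $\Delta^I=H$ if and only if $I$ is given by horizontal lifts, i.e. for all $\gamma:J\to M$, $s,t\in J$, $p\in\pi^{-1}(\gamma(s))$ there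 is a horizontal lift $c:J\to E$ of $\gamma$ with $c(s)=p$ and $I^\gamma_{s\to t}(p)=c(t)$. (c) $I\mapsto P$, $P^\gamma:=I^\gamma_{a\to b}$ for $\gamma:[a,b]\to M$, is a bijection from the regular transports along paths onto the parallel transports, and $I$ is recovered from $P$ by $I^\gamma_{s\to t}=P^{\gamma|[s,t]}$ for $s\le t$ and $I^\gamma_{s\to t}=(P^{\gamma|[t,s]})^{-1}$ for $t\le s$. (d) For a parallel transport $P$ every $\Delta^P_p$ is a linear subspace, and $P\mapsto\Delta^P$ is a bijection from the parallel transports onto the complete connections. For a connection $H$, $P$ is a parallel transport with $\Delta^P=H$ if and only if $P$ is generated by $H$, i.e. for all $\gamma:[a,b]\to M$ and $p\in\pi^{-1}(\gamma(a))$ there is a horizontal lift $c:[a,b]\to E$ of $\gamma$ with $c(a)=p$ and $P^\gamma(p)=c(b)$. (e) The three bijections are compatible: if $P$ corresponds to $I$ as in (c), then $\Delta^P=\Delta^I$. (f) Consequently the two systems of axioms are equivalent: for an assignment $\gamma\mapsto P^\gamma$ of maps $\pi^{-1}(\gamma(a))\to\pi^{-1}(\gamma(b))$ to the $C^1$ paths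 $\gamma:[a,b]\to M$, the following are equivalent: $P$ is a parallel transport; $P^\gamma=I^\gamma_{a\to b}$ for some regular transport along paths $I$; $P$ is generated by some connection. -/

import Mathlib

open Set
open scoped Manifold ContDiff

noncomputable section

section Basic

variable (V : Type*) [NormedAddCommGroup V] [NormedSpace ℝ V]
  {N : Type*} [TopologicalSpace N] [ChartedSpace V N]

/-- `γ`, restricted to `J`, is a `C¹` path in `N`: here `J` is a nonempty interval of any kind
(open or not, bounded or not, possibly reduced to a point), and only the values of `γ` on `J`
matter. -/
structure IsPath (γ : ℝ → N) (J : Set ℝ) : Prop where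
  nonempty : J.Nonempty
  ordConnected : J.OrdConnected
  contMDiffOn : ContMDiffOn 𝓘(ℝ, ℝ) 𝓘(ℝ, V) 1 γ J

/-- The velocity at `t` of the path `γ : J → N` (one-sided at the end-points of `J`), as a point of
the tangent bundle. -/
def velocity (γ : ℝ → N) (J : Set ℝ) (t : ℝ) : TangentBundle 𝓘(ℝ, V) N :=
  ⟨γ t, mfderivWithin 𝓘(ℝ, ℝ) 𝓘(ℝ, V) γ J t (1 : ℝ)⟩

/-- `X` is a vector field of class `C^k` on `U`. -/
def IsVectorFieldOn [IsManifold 𝓘(ℝ, V) 1 N] (k : ℕ∞)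
    (X : ∀ x : N, TangentSpace 𝓘(ℝ, V) x) (U : Set N) : Prop :=
  ContMDiffOn 𝓘(ℝ, V) 𝓘(ℝ, V).tangent k (fun x ↦ (⟨x, X x⟩ : TangentBundle 𝓘(ℝ, V) N)) U

end Basic

variable (VM : Type*) [NormedAddCommGroup VM] [NormedSpace ℝ VM]
  {M : Type*} [TopologicalSpace M] [ChartedSpace VM M]
  (VE : Type*) [NormedAddCommGroup VE] [NormedSpace ℝ VE]
  {E : Type*} [TopologicalSpace E] [ChartedSpace VE E]

/-- The fibre of `π` over `x`. -/
abbrev Fibre {M E : Type*} (π : E → M) (x : M) : Type _ := {p : E // π p = x}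

/-! ### Connections -/

/-- A `C^k` connection on `π : E → M`: a `C^k` distribution `H` on the bundle space, of rank
`dim M`, which is complementary to the vertical distribution `p ↦ ker dπ_p`. -/
structure IsConnection [IsManifold 𝓘(ℝ, VE) 1 E] (k : ℕ∞) (π : E → M)
    (H : ∀ p : E, Submodule ℝ (TangentSpace 𝓘(ℝ, VE) p)) : Prop where
  isCompl : ∀ p : E, IsCompl (H p) (mfderiv 𝓘(ℝ, VE) 𝓘(ℝ, VM) π p).ker
  smooth : ∀ p₀ : E, ∃ U : Set E, IsOpen U ∧ p₀ ∈ U ∧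
    ∃ Z : Fin (Module.finrank ℝ VM) → ∀ p : E, TangentSpace 𝓘(ℝ, VE) p,
      (∀ i, IsVectorFieldOn VE k (Z i) U) ∧
      ∀ p ∈ U, H p = Submodule.span ℝ (range fun i ↦ Z i p)

/-- `c : J → E` is a horizontal lift of `γ : J → M` with respect to the distribution `H`. -/
structure IsHorizontalLift (π : E → M) (H : ∀ p : E, Submodule ℝ (TangentSpace 𝓘(ℝ, VE) p))
    (γ : ℝ → M) (J : Set ℝ) (c : ℝ → E) : Prop where
  contMDiffOn : ContMDiffOn 𝓘(ℝ, ℝ) 𝓘(ℝ, VE) 1 c J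
  proj : ∀ t ∈ J, π (c t) = γ t
  horizontal : ∀ t ∈ J, (velocity VE c J t).2 ∈ H (c t)

/-- Every `C¹` path in the base has, through every point over it, a horizontal lift defined on the
whole interval. -/
def IsCompleteDistribution (π : E → M)
    (H : ∀ p : E, Submodule ℝ (TangentSpace 𝓘(ℝ, VE) p)) : Prop :=
  ∀ (γ : ℝ → M) (J : Set ℝ), IsPath VM γ J → ∀ s ∈ J, ∀ p : E, π p = γ s →
    ∃ c : ℝ → E, IsHorizontalLift VE π H γ J c ∧ c s = p

/-! ### Transports along paths -/

/-- A transport along (`C¹`) paths in `π : E → M`: to every path `γ : J → M` and all `s, t ∈ J`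
it assigns a map of the fibre over `γ s` into the fibre over `γ t`. -/
@[ext]
structure TransportAlongPaths (π : E → M) where
  map : ∀ (γ : ℝ → M) (J : Set ℝ), IsPath VM γ J → ∀ s t : ℝ, s ∈ J → t ∈ J →
    Fibre π (γ s) → Fibre π (γ t)
  /-- Only the values of `γ` on `J` matter. -/
  congr : ∀ (γ γ' : ℝ → M) (J : Set ℝ) (h : IsPath VM γ J) (h' : IsPath VM γ' J), EqOn γ γ' J →
    ∀ (s t : ℝ) (hs : s ∈ J) (ht : t ∈ J) (p : E) (hp : π p = γ s) (hp' : π p = γ' s),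
      (map γ J h s t hs ht ⟨p, hp⟩ : E) = map γ' J h' s t hs ht ⟨p, hp'⟩
  map_self : ∀ (γ : ℝ → M) (J : Set ℝ) (h : IsPath VM γ J) (s : ℝ) (hs : s ∈ J),
    map γ J h s s hs hs = id
  map_comp : ∀ (γ : ℝ → M) (J : Set ℝ) (h : IsPath VM γ J) (r s t : ℝ) (hr : r ∈ J) (hs : s ∈ J)
    (ht : t ∈ J), map γ J h s t hs ht ∘ map γ J h r s hr hs = map γ J h r t hr ht

namespace TransportAlongPaths

variable {VM} {π : E → M} (T : TransportAlongPaths VM π)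

open scoped Classical in
/-- The lift `t ↦ I^γ_{s → t} p` of `γ : J → M` through the point `p` over `γ s`. (The value outside
`J` is irrelevant.) -/
def lift (γ : ℝ → M) (J : Set ℝ) (h : IsPath VM γ J) (s : ℝ) (hs : s ∈ J)
    (p : Fibre π (γ s)) (t : ℝ) : E :=
  if ht : t ∈ J then (T.map γ J h s t hs ht p : E) else p

/-- `w ∈ T_p E` is the velocity at `p` of the lift through `p` of some `C¹` path which
passes through `π p` with velocity `v`. -/
def IsLiftVelocity (p : E) (v : TangentSpace 𝓘(ℝ, VM) (π p)) (w : TangentSpace 𝓘(ℝ, VE) p) :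
    Prop :=
  ∃ (γ : ℝ → M) (J : Set ℝ) (h : IsPath VM γ J) (s : ℝ) (hs : s ∈ J) (hp : π p = γ s),
    J.Nontrivial ∧ velocity VM γ J s = ⟨π p, v⟩ ∧
      velocity VE (T.lift γ J h s hs ⟨p, hp⟩) J s = ⟨p, w⟩

/-- The set of all velocities at `p` of lifts of `C¹` paths through `p`. -/
def liftVelocities (p : E) : Set (TangentSpace 𝓘(ℝ, VE) p) :=
  {w | ∃ v, T.IsLiftVelocity VE p v w}

/-- The distribution on `E` spanned by the velocities of the lifts. -/
def distribution (p : E) : Submodule ℝ (TangentSpace 𝓘(ℝ, VE) p) :=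
  Submodule.span ℝ (T.liftVelocities VE p)

/-- The additional conditions on a transport along paths. -/
structure IsRegular [IsManifold 𝓘(ℝ, VM) 1 M] [IsManifold 𝓘(ℝ, VE) 1 E] (k : ℕ∞) : Prop where
  /-- Compatibility with restriction of paths to subintervals. -/
  locality : ∀ (γ : ℝ → M) (J J' : Set ℝ) (h : IsPath VM γ J) (h' : IsPath VM γ J') (hJ : J' ⊆ J)
    (s t : ℝ) (hs : s ∈ J') (ht : t ∈ J'),
    T.map γ J' h' s t hs ht = T.map γ J h s t (hJ hs) (hJ ht)
  /-- Invariance under `C¹` diffeomorphisms `χ : J' → J` of intervals (of either orientation). -/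
  reparam : ∀ (γ : ℝ → M) (J J' : Set ℝ) (χ : ℝ → ℝ) (h : IsPath VM γ J)
    (h' : IsPath VM (γ ∘ χ) J') (hχ : BijOn χ J' J), ContDiffOn ℝ 1 χ J' →
    (∀ t ∈ J', derivWithin χ J' t ≠ 0) →
    ∀ (s t : ℝ) (hs : s ∈ J') (ht : t ∈ J'),
      T.map (γ ∘ χ) J' h' s t hs ht = T.map γ J h (χ s) (χ t) (hχ.mapsTo hs) (hχ.mapsTo ht)
  /-- The lifts of `C¹` paths are `C¹` paths. -/
  contMDiffOn_lift : ∀ (γ : ℝ → M) (J : Set ℝ) (h : IsPath VM γ J) (s : ℝ) (hs : s ∈ J)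
    (p : Fibre π (γ s)), ContMDiffOn 𝓘(ℝ, ℝ) 𝓘(ℝ, VE) 1 (T.lift γ J h s hs p) J
  /-- The velocity of a lift at `p` is determined by `p` and the velocity of the path below. -/
  velocity_unique : ∀ (p : E) (v : TangentSpace 𝓘(ℝ, VM) (π p)) (w w' : TangentSpace 𝓘(ℝ, VE) p),
    T.IsLiftVelocity VE p v w → T.IsLiftVelocity VE p v w' → w = w'
  /-- The lift to `E` of a `C^k` vector field on an open subset of `M` is a `C^k` vector field. -/
  smooth : ∀ (U : Set M) (X : ∀ x : M, TangentSpace 𝓘(ℝ, VM) x)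
    (Y : ∀ p : E, TangentSpace 𝓘(ℝ, VE) p), IsOpen U → IsVectorFieldOn VM k X U →
    (∀ p ∈ π ⁻¹' U, T.IsLiftVelocity VE p (X (π p)) (Y p)) → IsVectorFieldOn VE k Y (π ⁻¹' U)

/-- `T` is the transport by horizontal lifts with respect to `H`: the image of `p` under
`I^γ_{s → t}` is the value at `t` of a horizontal lift of `γ` through `p`. -/
def IsGeneratedBy (H : ∀ p : E, Submodule ℝ (TangentSpace 𝓘(ℝ, VE) p)) : Prop :=
  ∀ (γ : ℝ → M) (J : Set ℝ) (h : IsPath VM γ J) (s t : ℝ) (hs : s ∈ J) (ht : t ∈ J)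
    (p : Fibre π (γ s)),
    ∃ c : ℝ → E, IsHorizontalLift VE π H γ J c ∧ c s = p ∧ (T.map γ J h s t hs ht p : E) = c t

end TransportAlongPaths

/-! ### Parallel transports -/

/-- A mapping `γ ↦ P^γ` assigning to every `C¹` path `γ : [a, b] → M`, `a ≤ b`, a map of the fibre
over `γ a` into the fibre over `γ b`. -/
@[ext]
structure PathMapping (π : E → M) where
  map : ∀ (γ : ℝ → M) (a b : ℝ), IsPath VM γ (Icc a b) → Fibre π (γ a) → Fibre π (γ b)
  /-- Only the values of `γ` on `[a, b]` matter. -/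
  congr : ∀ (γ γ' : ℝ → M) (a b : ℝ) (h : IsPath VM γ (Icc a b)) (h' : IsPath VM γ' (Icc a b)),
    EqOn γ γ' (Icc a b) → ∀ (p : E) (hp : π p = γ a) (hp' : π p = γ' a),
      (map γ a b h ⟨p, hp⟩ : E) = map γ' a b h' ⟨p, hp'⟩

section Restrict

variable {VM}

theorem IsPath.mono {γ : ℝ → M} {J J' : Set ℝ} (h : IsPath VM γ J) (hJ : J' ⊆ J)
    (hne : J'.Nonempty) (hoc : J'.OrdConnected) : IsPath VM γ J' :=
  ⟨hne, hoc, h.contMDiffOn.mono hJ⟩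

theorem IsPath.Icc_initial {γ : ℝ → M} {a b t : ℝ} (h : IsPath VM γ (Icc a b))
    (ht : t ∈ Icc a b) : IsPath VM γ (Icc a t) :=
  h.mono (Icc_subset_Icc_right ht.2) (nonempty_Icc.2 ht.1) ordConnected_Icc

theorem IsPath.le {γ : ℝ → M} {a b : ℝ} (h : IsPath VM γ (Icc a b)) : a ≤ b :=
  nonempty_Icc.1 h.nonempty

end Restrict

namespace PathMapping

variable {VM} {π : E → M} (P : PathMapping VM π)

open scoped Classical in
/-- The lift `t ↦ P^{γ|[a, t]} p` of `γ : [a, b] → M` through the point `p` over `γ a`. (The value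
outside `[a, b]` is irrelevant.) -/
def lift (γ : ℝ → M) (a b : ℝ) (h : IsPath VM γ (Icc a b)) (p : Fibre π (γ a)) (t : ℝ) : E :=
  if ht : t ∈ Icc a b then (P.map γ a t (h.Icc_initial ht) p : E) else p

/-- `w ∈ T_p E` is the initial velocity of the lift from `p` of some `C¹` path which starts at
`π p` with velocity `v`. -/
def IsLiftVelocity (p : E) (v : TangentSpace 𝓘(ℝ, VM) (π p)) (w : TangentSpace 𝓘(ℝ, VE) p) :
    Prop :=
  ∃ (γ : ℝ → M) (a b : ℝ) (h : IsPath VM γ (Icc a b)) (hp : π p = γ a),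
    a < b ∧ velocity VM γ (Icc a b) a = ⟨π p, v⟩ ∧
      velocity VE (P.lift γ a b h ⟨p, hp⟩) (Icc a b) a = ⟨p, w⟩

/-- The set of all initial velocities of lifts from `p` of `C¹` paths. -/
def liftVelocities (p : E) : Set (TangentSpace 𝓘(ℝ, VE) p) :=
  {w | ∃ v, P.IsLiftVelocity VE p v w}

/-- The distribution on `E` spanned by the initial velocities of the lifts. -/
def distribution (p : E) : Submodule ℝ (TangentSpace 𝓘(ℝ, VE) p) :=
  Submodule.span ℝ (P.liftVelocities VE p)

/-- The axioms of a parallel transport (of class `C^k`). -/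
structure IsParallelTransport [IsManifold 𝓘(ℝ, VM) 1 M] [IsManifold 𝓘(ℝ, VE) 1 E] (k : ℕ∞) :
    Prop where
  /-- The transport along a one-point path is the identity. -/
  map_self : ∀ (γ : ℝ → M) (a : ℝ) (h : IsPath VM γ (Icc a a)), P.map γ a a h = id
  /-- The transport along the product of two paths is the composition of the transports. -/
  map_comp : ∀ (γ : ℝ → M) (a b c : ℝ) (hab : IsPath VM γ (Icc a b)) (hbc : IsPath VM γ (Icc b c))
    (hac : IsPath VM γ (Icc a c)), P.map γ b c hbc ∘ P.map γ a b hab = P.map γ a c hac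
  /-- The transport along the inverse path `t ↦ γ (a + b - t)` is the inverse map. -/
  map_inv : ∀ (γ : ℝ → M) (a b : ℝ) (h : IsPath VM γ (Icc a b))
    (h' : IsPath VM (fun t ↦ γ (a + b - t)) (Icc a b)) (p q : E) (hp : π p = γ a)
    (hq : π q = γ (a + b - a)),
    (P.map γ a b h ⟨p, hp⟩ : E) = q ↔ (P.map (fun t ↦ γ (a + b - t)) a b h' ⟨q, hq⟩ : E) = p
  /-- Invariance under orientation preserving `C¹` diffeomorphisms
  `χ : [a, b] → [χ a, χ b]`. -/
  reparam : ∀ (γ : ℝ → M) (a b : ℝ) (χ : ℝ → ℝ) (h : IsPath VM γ (Icc (χ a) (χ b)))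
    (h' : IsPath VM (γ ∘ χ) (Icc a b)), ContDiffOn ℝ 1 χ (Icc a b) →
    (∀ t ∈ Icc a b, 0 < derivWithin χ (Icc a b) t) →
    P.map (γ ∘ χ) a b h' = P.map γ (χ a) (χ b) h
  /-- The lifts of `C¹` paths are `C¹` paths. -/
  contMDiffOn_lift : ∀ (γ : ℝ → M) (a b : ℝ) (h : IsPath VM γ (Icc a b)) (p : Fibre π (γ a)),
    ContMDiffOn 𝓘(ℝ, ℝ) 𝓘(ℝ, VE) 1 (P.lift γ a b h p) (Icc a b)
  /-- The initial velocity of a lift from `p` is determined by `p` and the initial velocity of the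
  path below. -/
  velocity_unique : ∀ (p : E) (v : TangentSpace 𝓘(ℝ, VM) (π p)) (w w' : TangentSpace 𝓘(ℝ, VE) p),
    P.IsLiftVelocity VE p v w → P.IsLiftVelocity VE p v w' → w = w'
  /-- The lift to `E` of a `C^k` vector field on an open subset of `M` is a `C^k` vector field. -/
  smooth : ∀ (U : Set M) (X : ∀ x : M, TangentSpace 𝓘(ℝ, VM) x)
    (Y : ∀ p : E, TangentSpace 𝓘(ℝ, VE) p), IsOpen U → IsVectorFieldOn VM k X U →
    (∀ p ∈ π ⁻¹' U, P.IsLiftVelocity VE p (X (π p)) (Y p)) → IsVectorFieldOn VE k Y (π ⁻¹' U)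

/-- `P` is the parallel transport generated by `H`: the image of `p` under `P^γ`,
`γ : [a, b] → M`, is the end-point of a horizontal lift of `γ` starting at `p`. -/
def IsGeneratedBy (H : ∀ p : E, Submodule ℝ (TangentSpace 𝓘(ℝ, VE) p)) : Prop :=
  ∀ (γ : ℝ → M) (a b : ℝ) (h : IsPath VM γ (Icc a b)) (p : Fibre π (γ a)),
    ∃ c : ℝ → E, IsHorizontalLift VE π H γ (Icc a b) c ∧ c a = p ∧ (P.map γ a b h p : E) = c b

end PathMapping

/-- The mapping `γ ↦ P^γ := I^γ_{a → b}`, `γ : [a, b] → M`, defined by a transport along paths. -/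
def TransportAlongPaths.toPathMapping {VM} [NormedAddCommGroup VM] [NormedSpace ℝ VM]
    {M : Type*} [TopologicalSpace M] [ChartedSpace VM M] {E : Type*} {π : E → M}
    (T : TransportAlongPaths VM π) : PathMapping VM π where
  map γ a b h := T.map γ (Icc a b) h a b (left_mem_Icc.2 h.le) (right_mem_Icc.2 h.le)
  congr γ γ' a b h h' e p hp hp' := T.congr γ γ' (Icc a b) h h' e a b _ _ p hp hp'

end

open Set Filter
open scoped Manifold ContDiff Topology

set_option linter.unusedSectionVars false

/-! Transports along paths, parallel transports and complete connections all encode one object: a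
rule which singles out exactly one `C¹` lift of each path through each point over it, compatibly
with restriction and reparametrization. `IsLiftRule` records this, and `IsRegularLiftRule` adds the
two conditions on velocities. A transport or path mapping governed by a rule is determined by it,
and its axioms follow from the uniqueness of lifts. It therefore suffices to obtain a regular rule
from each structure and to compare regular rules with connections.

For a regular transport along paths the lifts are the curves `t ↦ I^γ_{s → t} p`. For a parallel
transport, which only moves forwards from initial points, the axiom on inverse paths makes the
transport maps invertible, so lifts extend to the left as well, and a reflection of the parameter
handles velocities at right end-points.

The central point is that the velocities of lifts through `p` form a linear subspace, although no
additivity is assumed. Reparametrization makes the lifting of vectors homogeneous. In the chart at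
`π p` consider the Euler field `x - π p`. Its lift is `C^k` with `1 ≤ k`, so it has a derivative at
`p`. It vanishes along the fibre of `p`, hence the derivative kills vertical vectors
(`mfderiv_eulerLift_of_vertical`). Along the lift of the line `π p + s v` it equals `s` times the
lift of the constant field `v`, hence the derivative fixes the lift of `v`
(`mfderiv_eulerLift_liftVec`). So the lifted vectors are exactly the fixed vectors of a linear map,
and they complement the vertical space; lifts of constant coordinate fields form a local `C^k`
frame.

Conversely, a horizontal vector of a connection is, in coordinates, `A q` applied to its projection,
with `A` of class `C^k` (`IsConnection.exists_coord`). A horizontal lift thus solves `x' = A x (g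
t)` with `A` locally Lipschitz and `g` continuous, which gives local uniqueness
(`IsConnection.eventually_eq_lift`) and, `E` being Hausdorff, global uniqueness. Completeness
supplies existence, so the horizontal lifts form a regular rule. -/

theorem Set.OrdConnected.uniqueDiffOn_real {J : Set ℝ} (hJ : J.OrdConnected)
    (hn : J.Nontrivial) : UniqueDiffOn ℝ J := by
  obtain ⟨a, ha, b, hb, hab⟩ := hn.exists_lt
  refine uniqueDiffOn_convex hJ.convex ?_
  have h : (interior (Icc a b)).Nonempty := by
    rw [interior_Icc]; exact nonempty_Ioo.2 hab
  exact h.mono (interior_mono (hJ.out ha hb))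

/-! ### Velocities of paths and tangent vectors in chart coordinates. -/

section Velocity

variable {V : Type*} [NormedAddCommGroup V] [NormedSpace ℝ V]
  {N : Type*} [TopologicalSpace N] [ChartedSpace V N]
  {V' : Type*} [NormedAddCommGroup V'] [NormedSpace ℝ V']
  {N' : Type*} [TopologicalSpace N'] [ChartedSpace V' N']

theorem ContMDiffOn.mdiffWithinAt {c : ℝ → N} {J : Set ℝ}
    (hc : ContMDiffOn 𝓘(ℝ, ℝ) 𝓘(ℝ, V) 1 c J) {t : ℝ} (ht : t ∈ J) :
    MDifferentiableWithinAt 𝓘(ℝ, ℝ) 𝓘(ℝ, V) c J t :=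
  (hc t ht).mdifferentiableWithinAt one_ne_zero

theorem velocity_congr {c c' : ℝ → N} {J : Set ℝ} (h : EqOn c c' J) {t : ℝ} (ht : t ∈ J) :
    velocity V c J t = velocity V c' J t := by
  have h2 : mfderivWithin 𝓘(ℝ, ℝ) 𝓘(ℝ, V) c J t (1 : ℝ) =
    mfderivWithin 𝓘(ℝ, ℝ) 𝓘(ℝ, V) c' J t (1 : ℝ) := by
    have := mfderivWithin_congr (I := 𝓘(ℝ, ℝ)) (I' := 𝓘(ℝ, V)) (f := c') (f₁ := c) (s := J) (x := t)
      (fun x hx ↦ h hx) (h ht)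
    exact congrArg (fun L : ℝ →L[ℝ] V ↦ L 1) this
  exact Bundle.TotalSpace.ext (h ht) (heq_of_eq h2)

theorem velocity_mono {c : ℝ → N} {J J' : Set ℝ} (hJ : J' ⊆ J) {t : ℝ} (ht : t ∈ J')
    (hu : UniqueDiffOn ℝ J') (hc : MDifferentiableWithinAt 𝓘(ℝ, ℝ) 𝓘(ℝ, V) c J t) :
    velocity V c J' t = velocity V c J t := by
  unfold velocity
  rw [mfderivWithin_subset hJ (hu.uniqueMDiffOn t ht) hc]

/-- A set with at most one point has no accumulation point, so the derivative within it takes the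
default value zero. Horizontality is therefore automatic on one-point intervals. -/
theorem velocity_snd_eq_zero {c : ℝ → N} {J : Set ℝ} (hJ : J.Subsingleton) (t : ℝ) :
    (velocity V c J t).2 = 0 := by
  have h0 : mfderivWithin 𝓘(ℝ, ℝ) 𝓘(ℝ, V) c J t = 0 := by
    by_cases h : MDifferentiableWithinAt 𝓘(ℝ, ℝ) 𝓘(ℝ, V) c J t
    · have hs : ((extChartAt 𝓘(ℝ, ℝ) t).symm ⁻¹' J ∩ range 𝓘(ℝ, ℝ) : Set ℝ).Subsingleton :=
        fun a ha b hb ↦ hJ ha.1 hb.1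
      refine h.mfderivWithin.trans (fderivWithin_zero_of_not_accPt fun hacc ↦ ?_)
      rw [accPt_iff_nhds] at hacc
      obtain ⟨y, hy, hyne⟩ := hacc univ univ_mem
      obtain ⟨z, hz, hzne⟩ := hacc {y}ᶜ (isOpen_compl_singleton.mem_nhds hyne.symm)
      exact hz.1 (hs hz.2 hy.2)
    · exact mfderivWithin_zero_of_not_mdifferentiableWithinAt h
  change (mfderivWithin 𝓘(ℝ, ℝ) 𝓘(ℝ, V) c J t) (1 : ℝ) = 0
  rw [h0]
  rfl

theorem velocity_comp {c : ℝ → N} {J J' : Set ℝ} {χ : ℝ → ℝ} {t : ℝ} (ht : t ∈ J')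
    (hu : UniqueDiffOn ℝ J') (hm : MapsTo χ J' J) (hχ : DifferentiableWithinAt ℝ χ J' t)
    (hc : MDifferentiableWithinAt 𝓘(ℝ, ℝ) 𝓘(ℝ, V) c J (χ t)) :
    velocity V (c ∘ χ) J' t = ⟨c (χ t), derivWithin χ J' t • (velocity V c J (χ t)).2⟩ := by
  unfold velocity
  rw [mfderivWithin_comp t hc hχ.mdifferentiableWithinAt hm (hu.uniqueMDiffOn t ht)]
  refine Bundle.TotalSpace.ext rfl (heq_of_eq ?_)
  change mfderivWithin 𝓘(ℝ, ℝ) 𝓘(ℝ, V) c J (χ t) (mfderivWithin 𝓘(ℝ, ℝ) 𝓘(ℝ, ℝ) χ J' t (1 : ℝ)) =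
    derivWithin χ J' t • (mfderivWithin 𝓘(ℝ, ℝ) 𝓘(ℝ, V) c J (χ t) (1 : ℝ))
  have h1 : mfderivWithin 𝓘(ℝ, ℝ) 𝓘(ℝ, ℝ) χ J' t (1 : ℝ) = derivWithin χ J' t • (1 : ℝ) := by
    rw [mfderivWithin_eq_fderivWithin, smul_eq_mul, mul_one]
    rfl
  rw [h1]
  exact map_smul (mfderivWithin 𝓘(ℝ, ℝ) 𝓘(ℝ, V) c J (χ t)) _ _

theorem tangentMap_velocity {f : N → N'} {c : ℝ → N} {J : Set ℝ} {t : ℝ} (ht : t ∈ J)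
    (hu : UniqueDiffOn ℝ J) (hf : MDifferentiableAt 𝓘(ℝ, V) 𝓘(ℝ, V') f (c t))
    (hc : MDifferentiableWithinAt 𝓘(ℝ, ℝ) 𝓘(ℝ, V) c J t) :
    tangentMap 𝓘(ℝ, V) 𝓘(ℝ, V') f (velocity V c J t) = velocity V' (f ∘ c) J t := by
  unfold velocity
  rw [mfderiv_comp_mfderivWithin t hf hc (hu.uniqueMDiffOn t ht)]
  rfl

/-- The coordinates of a tangent vector in the chart at `x₀`. -/
noncomputable def tangentCoord (x₀ : N) (z : TangentBundle 𝓘(ℝ, V) N) : V :=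
  mfderiv 𝓘(ℝ, V) 𝓘(ℝ, V) (extChartAt 𝓘(ℝ, V) x₀) z.1 z.2

/-- The tangent vector at `x` with given coordinates in the chart at `x₀`. -/
noncomputable def tangentOfCoord (x₀ x : N) (u : V) : TangentSpace 𝓘(ℝ, V) x :=
  (mfderiv 𝓘(ℝ, V) 𝓘(ℝ, V) (extChartAt 𝓘(ℝ, V) x₀) x).inverse u

theorem tangentCoord_smul (x₀ x : N) (a : ℝ) (v : TangentSpace 𝓘(ℝ, V) x) :
    tangentCoord x₀ ⟨x, a • v⟩ = a • tangentCoord x₀ ⟨x, v⟩ :=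
  map_smul _ _ _

theorem tangentCoord_zero (x₀ x : N) :
    tangentCoord x₀ ⟨x, (0 : TangentSpace 𝓘(ℝ, V) x)⟩ = 0 :=
  map_zero _

theorem tangentOfCoord_smul (x₀ x : N) (a : ℝ) (u : V) :
    tangentOfCoord x₀ x (a • u) = a • tangentOfCoord x₀ x u :=
  map_smul _ _ _

theorem tangentOfCoord_zero (x₀ x : N) : tangentOfCoord x₀ x (0 : V) = 0 :=
  map_zero _

variable [IsManifold 𝓘(ℝ, V) 1 N]

theorem tangentCoord_self (x : N) (v : TangentSpace 𝓘(ℝ, V) x) : tangentCoord x ⟨x, v⟩ = v := by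
  unfold tangentCoord
  rw [mfderiv_extChartAt_self]
  rfl

theorem tangentCoord_injective {x₀ x : N} (hx : x ∈ (chartAt V x₀).source)
    {v w : TangentSpace 𝓘(ℝ, V) x} (h : tangentCoord x₀ ⟨x, v⟩ = tangentCoord x₀ ⟨x, w⟩) :
    v = w :=
  (isInvertible_mfderiv_extChartAt (I := 𝓘(ℝ, V)) (x := x₀) (by simpa using hx)).injective h

theorem tangentCoord_tangentOfCoord {x₀ x : N} (hx : x ∈ (chartAt V x₀).source) (u : V) :
    tangentCoord x₀ ⟨x, tangentOfCoord x₀ x u⟩ = u :=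
  (isInvertible_mfderiv_extChartAt (I := 𝓘(ℝ, V)) (x := x₀) (by simpa using hx)).self_apply_inverse u

theorem tangentOfCoord_tangentCoord {x₀ x : N} (hx : x ∈ (chartAt V x₀).source)
    (v : TangentSpace 𝓘(ℝ, V) x) : tangentOfCoord x₀ x (tangentCoord x₀ ⟨x, v⟩) = v :=
  tangentCoord_injective hx (tangentCoord_tangentOfCoord hx _)

theorem tangentOfCoord_self (x : N) (u : V) : tangentOfCoord x x u = u := by
  have h := tangentCoord_tangentOfCoord (mem_chart_source V x) u
  rwa [tangentCoord_self] at h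

theorem trivializationAt_snd_eq_tangentCoord {x₀ x : N} (hx : x ∈ (chartAt V x₀).source)
    (v : TangentSpace 𝓘(ℝ, V) x) :
    (trivializationAt V (TangentSpace 𝓘(ℝ, V)) x₀ ⟨x, v⟩).2 = tangentCoord x₀ ⟨x, v⟩ := by
  have h1 : (trivializationAt V (TangentSpace 𝓘(ℝ, V)) x₀).continuousLinearMapAt ℝ x v =
      tangentCoord x₀ ⟨x, v⟩ :=
    congrArg (fun L : V →L[ℝ] V ↦ L v)
      (TangentBundle.continuousLinearMapAt_trivializationAt (I := 𝓘(ℝ, V)) hx)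
  rw [← h1, Bundle.Trivialization.continuousLinearMapAt_apply,
    Bundle.Trivialization.coe_linearMapAt_of_mem]
  simpa using hx

/-- Only the fibre component of a section matters, and near `x₀` the trivialization of the tangent
bundle is the derivative of the chart. -/
theorem contMDiffAt_vectorField_iff {k : WithTop ℕ∞} {X : ∀ x : N, TangentSpace 𝓘(ℝ, V) x}
    {x₀ : N} : ContMDiffAt 𝓘(ℝ, V) 𝓘(ℝ, V).tangent k
      (fun x ↦ (⟨x, X x⟩ : TangentBundle 𝓘(ℝ, V) N)) x₀ ↔
    ContMDiffAt 𝓘(ℝ, V) 𝓘(ℝ, V) k (fun x ↦ tangentCoord x₀ ⟨x, X x⟩) x₀ := by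
  rw [Bundle.contMDiffAt_section]
  refine Filter.EventuallyEq.contMDiffAt_iff ?_
  filter_upwards [(chartAt V x₀).open_source.mem_nhds (mem_chart_source V x₀)] with x hx
  exact trivializationAt_snd_eq_tangentCoord hx _

/-- The bridge from velocities on the manifold to ordinary derivatives, used to turn horizontality
into a differential equation. -/
theorem tangentCoord_velocity {x₀ : N} {c : ℝ → N} {J : Set ℝ} {t : ℝ}
    (hs : c t ∈ (chartAt V x₀).source)
    (hc : MDifferentiableWithinAt 𝓘(ℝ, ℝ) 𝓘(ℝ, V) c J t) :
    HasDerivWithinAt (extChartAt 𝓘(ℝ, V) x₀ ∘ c) (tangentCoord x₀ (velocity V c J t)) J t := by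
  have hf : MDifferentiableAt 𝓘(ℝ, V) 𝓘(ℝ, V) (extChartAt 𝓘(ℝ, V) x₀) (c t) :=
    mdifferentiableAt_extChartAt hs
  have h1 := (hf.hasMFDerivAt.comp_hasMFDerivWithinAt t hc.hasMFDerivWithinAt)
  rw [hasMFDerivWithinAt_iff_hasFDerivWithinAt] at h1
  have h2 : HasFDerivWithinAt (extChartAt 𝓘(ℝ, V) x₀ ∘ c)
    ((mfderiv 𝓘(ℝ, V) 𝓘(ℝ, V) (extChartAt 𝓘(ℝ, V) x₀) (c t) ∘L
      mfderivWithin 𝓘(ℝ, ℝ) 𝓘(ℝ, V) c J t : ℝ →L[ℝ] V)) J t := h1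
  have h3 : HasDerivWithinAt (extChartAt 𝓘(ℝ, V) x₀ ∘ c)
    ((mfderiv 𝓘(ℝ, V) 𝓘(ℝ, V) (extChartAt 𝓘(ℝ, V) x₀) (c t) ∘L
      mfderivWithin 𝓘(ℝ, ℝ) 𝓘(ℝ, V) c J t : ℝ →L[ℝ] V) 1) J t := h2.hasDerivWithinAt
  exact h3

theorem tangentBundle_ext_coord {x₀ : N} {z z' : TangentBundle 𝓘(ℝ, V) N} (h : z.1 = z'.1)
    (hs : z.1 ∈ (chartAt V x₀).source) (hz : tangentCoord x₀ z = tangentCoord x₀ z') : z = z' := by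
  obtain ⟨x, v⟩ := z
  obtain ⟨x', v'⟩ := z'
  obtain rfl : x = x' := h
  rw [tangentCoord_injective hs hz]

/-- Through every point passes a path which is a straight line in the chart at this point and has
a given velocity. -/
theorem exists_isPath_velocity (x : N) (v : V) :
    ∃ (γ : ℝ → N) (ε : ℝ), 0 < ε ∧ IsPath V γ (Icc (-ε) ε) ∧ γ 0 = x ∧
      velocity V γ (Icc (-ε) ε) 0 = ⟨x, v⟩ ∧ ∀ s ∈ Icc (-ε) ε, γ s ∈ (chartAt V x).source ∧
        extChartAt 𝓘(ℝ, V) x (γ s) = extChartAt 𝓘(ℝ, V) x x + s • v := by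
  let l : ℝ → V := fun s ↦ extChartAt 𝓘(ℝ, V) x x + s • v
  have hl : ContDiff ℝ 1 l := by fun_prop
  have hl0 : l 0 = extChartAt 𝓘(ℝ, V) x x := by simp only [l, zero_smul, add_zero]
  have hnear : ∀ᶠ s in 𝓝 (0 : ℝ), l s ∈ (extChartAt 𝓘(ℝ, V) x).target := by
    refine hl.continuous.continuousAt.eventually ?_
    rw [hl0]
    exact extChartAt_target_mem_nhds x
  obtain ⟨ε, hε, hball⟩ := Metric.nhds_basis_closedBall.eventually_iff.1 hnear
  rw [Real.closedBall_eq_Icc, zero_sub, zero_add] at hball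
  have h0 : (0 : ℝ) ∈ Icc (-ε) ε := ⟨by linarith, hε.le⟩
  let γ : ℝ → N := (extChartAt 𝓘(ℝ, V) x).symm ∘ l
  have hγ : ContMDiffOn 𝓘(ℝ, ℝ) 𝓘(ℝ, V) 1 γ (Icc (-ε) ε) :=
    (contMDiffOn_extChartAt_symm x).comp hl.contMDiff.contMDiffOn fun s hs ↦ hball hs
  have hγ0 : γ 0 = x := by simp only [γ, Function.comp, hl0, extChartAt_to_inv]
  have hsrc : ∀ s ∈ Icc (-ε) ε, γ s ∈ (chartAt V x).source := fun s hs ↦ by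
    rw [← extChartAt_source 𝓘(ℝ, V)]
    exact (extChartAt 𝓘(ℝ, V) x).map_target (hball hs)
  have hval : ∀ s ∈ Icc (-ε) ε, extChartAt 𝓘(ℝ, V) x (γ s) = l s := fun s hs ↦
    (extChartAt 𝓘(ℝ, V) x).right_inv (hball hs)
  refine ⟨γ, ε, hε, ⟨⟨0, h0⟩, ordConnected_Icc, hγ⟩, hγ0, ?_, fun s hs ↦ ⟨hsrc s hs, hval s hs⟩⟩
  refine tangentBundle_ext_coord (x₀ := x) hγ0 (hsrc 0 h0) ?_
  have h1 := tangentCoord_velocity (hsrc 0 h0) (hγ.mdiffWithinAt h0)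
  have h2 : HasDerivWithinAt (extChartAt 𝓘(ℝ, V) x ∘ γ) v (Icc (-ε) ε) 0 := by
    have h3 : HasDerivAt l v 0 := by
      simpa [l] using ((hasDerivAt_id (0 : ℝ)).smul_const v).const_add (extChartAt 𝓘(ℝ, V) x x)
    exact h3.hasDerivWithinAt.congr hval (hval 0 h0)
  exact ((uniqueDiffOn_Icc (by linarith) 0 h0).eq_deriv _ h1 h2).trans
    (tangentCoord_self x v).symm

end Velocity

/-! ### Compact subintervals as relative neighbourhoods. -/

section Intervals

/-- On each side of `t` one takes a point of `J` strictly beyond `t` if there is one, and `t` itself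
if `t` is an end-point of `J`. Enlarging the interval to contain `s` allows comparison with lifts
prescribed at `s`. -/
theorem exists_Icc_mem_nhdsWithin {J : Set ℝ} {s t : ℝ}
    (hs : s ∈ J) (ht : t ∈ J) : ∃ a ∈ J, ∃ b ∈ J, s ∈ Icc a b ∧ t ∈ Icc a b ∧ Icc a b ∈ 𝓝[J] t := by
  obtain ⟨a, ha, hat, hb⟩ : ∃ a ∈ J, a ≤ t ∧ Ici a ∈ 𝓝[J] t := by
    by_cases h : ∃ a ∈ J, a < t
    · obtain ⟨a, ha, hat⟩ := h
      exact ⟨a, ha, hat.le, mem_nhdsWithin_of_mem_nhds (Ici_mem_nhds hat)⟩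
    · push Not at h
      exact ⟨t, ht, le_rfl, mem_of_superset self_mem_nhdsWithin h⟩
  obtain ⟨b, hbJ, htb, hb'⟩ : ∃ b ∈ J, t ≤ b ∧ Iic b ∈ 𝓝[J] t := by
    by_cases h : ∃ b ∈ J, t < b
    · obtain ⟨b, hb, htb⟩ := h
      exact ⟨b, hb, htb.le, mem_nhdsWithin_of_mem_nhds (Iic_mem_nhds htb)⟩
    · push Not at h
      exact ⟨t, ht, le_rfl, mem_of_superset self_mem_nhdsWithin h⟩
  refine ⟨min a s, ?_, max b s, ?_, ⟨min_le_right _ _, le_max_right _ _⟩,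
    ⟨(min_le_left _ _).trans hat, htb.trans (le_max_left _ _)⟩, ?_⟩
  · rcases min_choice a s with h | h <;> rwa [h]
  · rcases max_choice b s with h | h <;> rwa [h]
  · filter_upwards [hb, hb'] with x hx hx'
    exact ⟨(min_le_left _ _).trans hx, le_trans hx' (le_max_left _ _)⟩

theorem contMDiffOn_of_forall_Icc {V : Type*} [NormedAddCommGroup V] [NormedSpace ℝ V]
    {N : Type*} [TopologicalSpace N] [ChartedSpace V N] {c : ℝ → N} {J : Set ℝ}
    (h : ∀ a ∈ J, ∀ b ∈ J, a ≤ b → ContMDiffOn 𝓘(ℝ, ℝ) 𝓘(ℝ, V) 1 c (Icc a b)) :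
    ContMDiffOn 𝓘(ℝ, ℝ) 𝓘(ℝ, V) 1 c J := by
  intro t ht
  obtain ⟨a, ha, b, hb, -, htab, hn⟩ := exists_Icc_mem_nhdsWithin ht ht
  exact (h a ha b hb (htab.1.trans htab.2) t htab).mono_of_mem_nhdsWithin hn

end Intervals

/-! ### Lift rules: a common framework for transports and horizontal lifts. -/

section LiftRule

variable (VM : Type*) [NormedAddCommGroup VM] [NormedSpace ℝ VM]
  {M : Type*} [TopologicalSpace M] [ChartedSpace VM M]
  (VE : Type*) [NormedAddCommGroup VE] [NormedSpace ℝ VE]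
  {E : Type*} [TopologicalSpace E] [ChartedSpace VE E]

/-- A rule `Λ` which singles out certain `C¹` lifts `c : J → E` of the `C¹` paths `γ : J → M`, such
that there is exactly one of them through every point over a point of the path. -/
structure IsLiftRule (π : E → M) (Λ : (ℝ → M) → Set ℝ → (ℝ → E) → Prop) : Prop where
  proj : ∀ {γ J c}, Λ γ J c → ∀ t ∈ J, π (c t) = γ t
  congr : ∀ {γ γ' J c}, IsPath VM γ J → Λ γ J c → EqOn γ γ' J → Λ γ' J c
  exists_lift : ∀ {γ J}, IsPath VM γ J → ∀ s ∈ J, ∀ p, π p = γ s → ∃ c, Λ γ J c ∧ c s = p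
  unique : ∀ {γ J c c'}, IsPath VM γ J → Λ γ J c → Λ γ J c' → ∀ s ∈ J, c s = c' s → EqOn c c' J
  mono : ∀ {γ J J' c}, IsPath VM γ J → Λ γ J c → J' ⊆ J → IsPath VM γ J' → Λ γ J' c
  reparam : ∀ {γ J J' c} {χ : ℝ → ℝ}, IsPath VM γ J → IsPath VM (γ ∘ χ) J' → BijOn χ J' J →
    ContDiffOn ℝ 1 χ J' → (∀ t ∈ J', derivWithin χ J' t ≠ 0) → Λ γ J c → Λ (γ ∘ χ) J' (c ∘ χ)
  contMDiffOn : ∀ {γ J c}, IsPath VM γ J → Λ γ J c → ContMDiffOn 𝓘(ℝ, ℝ) 𝓘(ℝ, VE) 1 c J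

/-- `w` is the velocity at `p` of some lift of a path with velocity `v` at `π p`. -/
def RuleVelocity (π : E → M) (Λ : (ℝ → M) → Set ℝ → (ℝ → E) → Prop) (p : E)
    (v : TangentSpace 𝓘(ℝ, VM) (π p)) (w : TangentSpace 𝓘(ℝ, VE) p) : Prop :=
  ∃ (γ : ℝ → M) (J : Set ℝ) (c : ℝ → E) (s : ℝ), IsPath VM γ J ∧ Λ γ J c ∧ s ∈ J ∧ c s = p ∧
    J.Nontrivial ∧ velocity VM γ J s = ⟨π p, v⟩ ∧ velocity VE c J s = ⟨p, w⟩

/-- A lift rule is regular if the velocity of a lift at a point is determined by the velocity of the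
path, and if `C^k` vector fields are lifted to `C^k` vector fields. -/
structure IsRegularLiftRule [IsManifold 𝓘(ℝ, VM) 1 M] [IsManifold 𝓘(ℝ, VE) 1 E] (k : ℕ∞)
    (π : E → M) (Λ : (ℝ → M) → Set ℝ → (ℝ → E) → Prop) : Prop
    extends IsLiftRule VM VE π Λ where
  velocity_unique : ∀ (p : E) (v : TangentSpace 𝓘(ℝ, VM) (π p)) (w w' : TangentSpace 𝓘(ℝ, VE) p),
    RuleVelocity VM VE π Λ p v w → RuleVelocity VM VE π Λ p v w' → w = w'
  smooth : ∀ (U : Set M) (X : ∀ x : M, TangentSpace 𝓘(ℝ, VM) x)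
    (Y : ∀ p : E, TangentSpace 𝓘(ℝ, VE) p), IsOpen U → IsVectorFieldOn VM k X U →
    (∀ p ∈ π ⁻¹' U, RuleVelocity VM VE π Λ p (X (π p)) (Y p)) → IsVectorFieldOn VE k Y (π ⁻¹' U)

variable {VM VE} {π : E → M} {Λ : (ℝ → M) → Set ℝ → (ℝ → E) → Prop}

/-- The transport `T` is the transport by means of the lifts singled out by `Λ`. -/
def TransportAlongPaths.IsGovernedBy (T : TransportAlongPaths VM π)
    (Λ : (ℝ → M) → Set ℝ → (ℝ → E) → Prop) : Prop :=
  ∀ (γ : ℝ → M) (J : Set ℝ) (h : IsPath VM γ J) (s t : ℝ) (hs : s ∈ J) (ht : t ∈ J)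
    (p : Fibre π (γ s)), ∃ c : ℝ → E, Λ γ J c ∧ c s = p ∧ (T.map γ J h s t hs ht p : E) = c t

/-- The path mapping `P` is given by the lifts singled out by `Λ`. -/
def PathMapping.IsGovernedBy (P : PathMapping VM π)
    (Λ : (ℝ → M) → Set ℝ → (ℝ → E) → Prop) : Prop :=
  ∀ (γ : ℝ → M) (a b : ℝ) (h : IsPath VM γ (Icc a b)) (p : Fibre π (γ a)),
    ∃ c : ℝ → E, Λ γ (Icc a b) c ∧ c a = p ∧ (P.map γ a b h p : E) = c b

theorem IsPath.comp_bijOn {γ : ℝ → M} {J J' : Set ℝ} {χ : ℝ → ℝ} (h : IsPath VM γ J)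
    (hχ : BijOn χ J' J) (hd : ContDiffOn ℝ 1 χ J') (hJ' : J'.OrdConnected) :
    IsPath VM (γ ∘ χ) J' :=
  ⟨by rw [← image_nonempty (f := χ), hχ.image_eq]; exact h.nonempty, hJ',
    h.contMDiffOn.comp hd.contMDiffOn hχ.mapsTo⟩

/-- The lift rule can be described by a transport along paths. -/
theorem IsLiftRule.exists_transport (hΛ : IsLiftRule VM VE π Λ) :
    ∃ T : TransportAlongPaths VM π, T.IsGovernedBy Λ := by
  choose! c hc hcs using fun γ J ↦ hΛ.exists_lift (γ := γ) (J := J)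
  -- The lift chosen through a point of another chosen lift is that same lift, whatever `γ` is
  -- outside `J`. With `t = s` this gives the congruence axiom, with `γ' = γ` the composition law.
  have key : ∀ {γ γ' J} (h : IsPath VM γ J) (h' : IsPath VM γ' J) (e : EqOn γ γ' J) {s t : ℝ}
      (hs : s ∈ J) (ht : t ∈ J) {p q : E} (hp : π p = γ s) (hq : π q = γ' t),
      c γ J s p t = q → EqOn (c γ J s p) (c γ' J t q) J := by
    intro γ γ' J h h' e s t hs ht p q hp hq hpq
    refine hΛ.unique h' (hΛ.congr h (hc γ J h s hs p hp) e) (hc γ' J h' t ht q hq) t ht ?_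
    rw [hcs γ' J h' t ht q hq, hpq]
  refine ⟨⟨fun γ J h s t hs ht p ↦ ⟨c γ J s p t, hΛ.proj (hc γ J h s hs p p.2) t ht⟩, ?_, ?_, ?_⟩, ?_⟩
  · intro γ γ' J h h' e s t hs ht p hp hp'
    exact key h h' e hs hs hp hp' (hcs γ J h s hs p hp) ht
  · intro γ J h s hs
    funext p
    exact Subtype.ext (hcs γ J h s hs p p.2)
  · intro γ J h r s t hr hs ht
    funext p
    exact Subtype.ext (key h h (eqOn_refl _ _) hr hs p.2 (hΛ.proj (hc γ J h r hr p p.2) s hs)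
      rfl ht).symm
  · intro γ J h s t hs ht p
    exact ⟨c γ J s p, hc γ J h s hs p p.2, hcs γ J h s hs p p.2, rfl⟩

theorem TransportAlongPaths.IsGovernedBy.map_eq {T : TransportAlongPaths VM π}
    (hT : T.IsGovernedBy Λ) (hΛ : IsLiftRule VM VE π Λ) {γ : ℝ → M} {J : Set ℝ}
    (h : IsPath VM γ J) {c : ℝ → E} (hc : Λ γ J c) {s t : ℝ} (hs : s ∈ J) (ht : t ∈ J)
    (p : Fibre π (γ s)) (hp : c s = p) : (T.map γ J h s t hs ht p : E) = c t := by
  obtain ⟨c', hc', hs', ht'⟩ := hT γ J h s t hs ht p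
  rw [ht', hΛ.unique h hc' hc s hs (hs'.trans hp.symm) ht]

theorem TransportAlongPaths.IsGovernedBy.unique {T T' : TransportAlongPaths VM π}
    (hΛ : IsLiftRule VM VE π Λ) (hT : T.IsGovernedBy Λ) (hT' : T'.IsGovernedBy Λ) : T = T' := by
  ext γ J h s t hs ht p
  obtain ⟨c, hc, hcs, hct⟩ := hT γ J h s t hs ht p
  rw [hct, hT'.map_eq hΛ h hc hs ht p hcs]

theorem TransportAlongPaths.IsGovernedBy.eqOn_lift {T : TransportAlongPaths VM π}
    (hT : T.IsGovernedBy Λ) (hΛ : IsLiftRule VM VE π Λ) {γ : ℝ → M} {J : Set ℝ}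
    (h : IsPath VM γ J) {c : ℝ → E} (hc : Λ γ J c) {s : ℝ} (hs : s ∈ J)
    (p : Fibre π (γ s)) (hp : c s = p) : EqOn (T.lift γ J h s hs p) c J := by
  intro t ht
  rw [TransportAlongPaths.lift, dif_pos ht, hT.map_eq hΛ h hc hs ht p hp]

theorem PathMapping.IsGovernedBy.map_eq {P : PathMapping VM π}
    (hP : P.IsGovernedBy Λ) (hΛ : IsLiftRule VM VE π Λ) {γ : ℝ → M} {a b : ℝ}
    (h : IsPath VM γ (Icc a b)) {c : ℝ → E} (hc : Λ γ (Icc a b) c)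
    (p : Fibre π (γ a)) (hp : c a = p) : (P.map γ a b h p : E) = c b := by
  obtain ⟨c', hc', hs', ht'⟩ := hP γ a b h p
  rw [ht', hΛ.unique h hc' hc a (left_mem_Icc.2 h.le) (hs'.trans hp.symm) (right_mem_Icc.2 h.le)]

theorem PathMapping.IsGovernedBy.unique {P P' : PathMapping VM π}
    (hΛ : IsLiftRule VM VE π Λ) (hP : P.IsGovernedBy Λ) (hP' : P'.IsGovernedBy Λ) : P = P' := by
  ext γ a b h p
  obtain ⟨c, hc, hcs, hct⟩ := hP γ a b h p
  rw [hct, hP'.map_eq hΛ h hc p hcs]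

theorem PathMapping.IsGovernedBy.eqOn_lift {P : PathMapping VM π}
    (hP : P.IsGovernedBy Λ) (hΛ : IsLiftRule VM VE π Λ) {γ : ℝ → M} {a b : ℝ}
    (h : IsPath VM γ (Icc a b)) {c : ℝ → E} (hc : Λ γ (Icc a b) c)
    (p : Fibre π (γ a)) (hp : c a = p) : EqOn (P.lift γ a b h p) c (Icc a b) := by
  intro t ht
  rw [PathMapping.lift, dif_pos ht, hP.map_eq hΛ (h.Icc_initial ht)
    (hΛ.mono h hc (Icc_subset_Icc_right ht.2) (h.Icc_initial ht)) p hp]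

theorem TransportAlongPaths.IsGovernedBy.toPathMapping {T : TransportAlongPaths VM π}
    (hT : T.IsGovernedBy Λ) : T.toPathMapping.IsGovernedBy Λ :=
  fun γ a b h p ↦ hT γ (Icc a b) h a b _ _ p

theorem TransportAlongPaths.IsGovernedBy.isLiftVelocity_iff {T : TransportAlongPaths VM π}
    (hT : T.IsGovernedBy Λ) (hΛ : IsLiftRule VM VE π Λ) {p : E}
    {v : TangentSpace 𝓘(ℝ, VM) (π p)} {w : TangentSpace 𝓘(ℝ, VE) p} :
    T.IsLiftVelocity VE p v w ↔ RuleVelocity VM VE π Λ p v w := by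
  constructor
  · rintro ⟨γ, J, h, s, hs, hp, hJ, hv, hw⟩
    obtain ⟨c, hc, hcs⟩ := hΛ.exists_lift h s hs p hp
    refine ⟨γ, J, c, s, h, hc, hs, hcs, hJ, hv, ?_⟩
    rw [← hw]
    exact (velocity_congr (hT.eqOn_lift hΛ h hc hs ⟨p, hp⟩ hcs) hs).symm
  · rintro ⟨γ, J, c, s, h, hc, hs, rfl, hJ, hv, hw⟩
    refine ⟨γ, J, h, s, hs, hΛ.proj hc s hs, hJ, hv, ?_⟩
    rw [← hw]
    exact velocity_congr (hT.eqOn_lift hΛ h hc hs ⟨c s, _⟩ rfl) hs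

theorem TransportAlongPaths.IsGovernedBy.liftVelocities_eq {T : TransportAlongPaths VM π}
    (hT : T.IsGovernedBy Λ) (hΛ : IsLiftRule VM VE π Λ) (p : E) :
    T.liftVelocities VE p = {w | ∃ v, RuleVelocity VM VE π Λ p v w} := by
  ext w
  exact exists_congr fun v ↦ hT.isLiftVelocity_iff hΛ

variable [IsManifold 𝓘(ℝ, VM) 1 M] [IsManifold 𝓘(ℝ, VE) 1 E] {k : ℕ∞}

/-- Restricting or reparametrizing a lift yields a lift through the corresponding point; by
uniqueness it is the one that the transport uses. -/
theorem TransportAlongPaths.IsGovernedBy.isRegular {T : TransportAlongPaths VM π}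
    (hT : T.IsGovernedBy Λ) (hΛ : IsRegularLiftRule VM VE k π Λ) : T.IsRegular VE k where
  locality γ J J' h h' hJ s t hs ht := by
    funext p
    obtain ⟨c, hc, hcs⟩ := hΛ.exists_lift h s (hJ hs) p p.2
    refine Subtype.ext ?_
    rw [hT.map_eq hΛ.toIsLiftRule h hc (hJ hs) (hJ ht) p hcs,
      hT.map_eq hΛ.toIsLiftRule h' (hΛ.mono h hc hJ h') hs ht p hcs]
  reparam γ J J' χ h h' hχ hd hd' s t hs ht := by
    funext p
    obtain ⟨c, hc, hcs⟩ := hΛ.exists_lift h (χ s) (hχ.mapsTo hs) p p.2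
    refine Subtype.ext ?_
    refine (hT.map_eq hΛ.toIsLiftRule h' (hΛ.reparam h h' hχ hd hd' hc) hs ht p hcs).trans ?_
    exact (hT.map_eq hΛ.toIsLiftRule h hc _ _ p hcs).symm
  contMDiffOn_lift γ J h s hs p := by
    obtain ⟨c, hc, hcs⟩ := hΛ.exists_lift h s hs p p.2
    exact (hΛ.contMDiffOn h hc).congr (hT.eqOn_lift hΛ.toIsLiftRule h hc hs p hcs)
  velocity_unique p v w w' hw hw' :=
    hΛ.velocity_unique p v w w' ((hT.isLiftVelocity_iff hΛ.toIsLiftRule).1 hw)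
      ((hT.isLiftVelocity_iff hΛ.toIsLiftRule).1 hw')
  smooth U X Y hU hX hY :=
    hΛ.smooth U X Y hU hX fun p hp ↦ (hT.isLiftVelocity_iff hΛ.toIsLiftRule).1 (hY p hp)

/-- Every tangent vector of the base is the velocity of some path, which has a lift. -/
theorem IsLiftRule.exists_velocity (hΛ : IsLiftRule VM VE π Λ) (p : E)
    (v : VM) :
    ∃ (γ : ℝ → M) (ε : ℝ) (c : ℝ → E) (w : TangentSpace 𝓘(ℝ, VE) p), 0 < ε ∧
      IsPath VM γ (Icc (-ε) ε) ∧ Λ γ (Icc (-ε) ε) c ∧ c 0 = p ∧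
      velocity VM γ (Icc (-ε) ε) 0 = ⟨π p, v⟩ ∧ velocity VE c (Icc (-ε) ε) 0 = ⟨p, w⟩ ∧
      ∀ s ∈ Icc (-ε) ε, γ s ∈ (chartAt VM (π p)).source ∧
        extChartAt 𝓘(ℝ, VM) (π p) (γ s) = extChartAt 𝓘(ℝ, VM) (π p) (π p) + s • v := by
  obtain ⟨γ, ε, hε, hγ, h0, hv, hlin⟩ := exists_isPath_velocity (π p) v
  obtain ⟨c, hc, hc0⟩ := hΛ.exists_lift hγ 0 ⟨by linarith, hε.le⟩ p h0.symm
  subst hc0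
  exact ⟨γ, ε, c, (velocity VE c (Icc (-ε) ε) 0).2, hε, hγ, hc, rfl, hv, rfl, hlin⟩

end LiftRule

/-! ### Diffeomorphisms of intervals. -/

section Reparametrization

theorem velocity_comp_eq {V : Type*} [NormedAddCommGroup V] [NormedSpace ℝ V]
    {N : Type*} [TopologicalSpace N] [ChartedSpace V N] {c : ℝ → N} {J J' : Set ℝ} {χ : ℝ → ℝ}
    {t : ℝ} (ht : t ∈ J') (hu : UniqueDiffOn ℝ J') (hm : MapsTo χ J' J)
    (hχ : DifferentiableWithinAt ℝ χ J' t)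
    (hc : MDifferentiableWithinAt 𝓘(ℝ, ℝ) 𝓘(ℝ, V) c J (χ t)) {x : N} {v : TangentSpace 𝓘(ℝ, V) x}
    (hv : velocity V c J (χ t) = ⟨x, v⟩) :
    velocity V (c ∘ χ) J' t = ⟨x, derivWithin χ J' t • v⟩ :=
  (velocity_comp ht hu hm hχ hc).trans
    (congrArg (fun z : TangentBundle 𝓘(ℝ, V) N ↦
      (⟨z.1, derivWithin χ J' t • z.2⟩ : TangentBundle 𝓘(ℝ, V) N)) hv)

theorem Set.OrdConnected.preimage_mul_left {J : Set ℝ} (hJ : J.OrdConnected) (a : ℝ) :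
    ((fun t ↦ a * t) ⁻¹' J).OrdConnected := by
  rcases le_total 0 a with h | h
  · exact hJ.preimage_mono fun x y hxy ↦ mul_le_mul_of_nonneg_left hxy h
  · exact hJ.preimage_anti fun x y hxy ↦ mul_le_mul_of_nonpos_left hxy h

theorem bijOn_Icc_of_derivWithin_pos {χ : ℝ → ℝ} {a b : ℝ} (hd : ContDiffOn ℝ 1 χ (Icc a b))
    (hab : a ≤ b) (hpos : ∀ t ∈ Icc a b, 0 < derivWithin χ (Icc a b) t) :
    BijOn χ (Icc a b) (Icc (χ a) (χ b)) := by
  have hmono : StrictMonoOn χ (Icc a b) := by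
    refine strictMonoOn_of_deriv_pos (convex_Icc a b) hd.continuousOn fun x hx ↦ ?_
    rw [← derivWithin_of_mem_nhds (mem_interior_iff_mem_nhds.1 hx)]
    exact hpos x (interior_subset hx)
  exact ⟨hmono.monotoneOn.mapsTo_Icc, hmono.injOn, intermediate_value_Icc hab hd.continuousOn⟩

theorem bijOn_Icc_sub (a b : ℝ) : BijOn (fun t ↦ a + b - t) (Icc a b) (Icc a b) :=
  ⟨fun t ht ↦ ⟨by linarith [ht.2], by linarith [ht.1]⟩, fun s _ t _ h ↦ by simpa using h,
    fun t ht ↦ ⟨a + b - t, ⟨by linarith [ht.2], by linarith [ht.1]⟩, by ring⟩⟩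

end Reparametrization

/-! ### Scaling and reversal of lifts, and the axioms of transports. -/

section LiftRule

variable {VM : Type*} [NormedAddCommGroup VM] [NormedSpace ℝ VM]
  {M : Type*} [TopologicalSpace M] [ChartedSpace VM M]
  {VE : Type*} [NormedAddCommGroup VE] [NormedSpace ℝ VE]
  {E : Type*} [TopologicalSpace E] [ChartedSpace VE E]
  {π : E → M} {Λ : (ℝ → M) → Set ℝ → (ℝ → E) → Prop}

/-- Scaling of the parameter of a lifted path. -/
theorem IsLiftRule.scale (hΛ : IsLiftRule VM VE π Λ) {γ : ℝ → M} {J : Set ℝ} {c : ℝ → E} {s : ℝ}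
    (h : IsPath VM γ J) (hc : Λ γ J c) (hs : s ∈ J) (hJ : J.Nontrivial) {x : M} {p : E}
    {v : TangentSpace 𝓘(ℝ, VM) x} {w : TangentSpace 𝓘(ℝ, VE) p}
    (hv : velocity VM γ J s = ⟨x, v⟩) (hw : velocity VE c J s = ⟨p, w⟩) {a : ℝ} (ha : a ≠ 0) :
    let χ : ℝ → ℝ := fun t ↦ a * t
    IsPath VM (γ ∘ χ) (χ ⁻¹' J) ∧ Λ (γ ∘ χ) (χ ⁻¹' J) (c ∘ χ) ∧ (χ ⁻¹' J).Nontrivial ∧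
      velocity VM (γ ∘ χ) (χ ⁻¹' J) (a⁻¹ * s) = ⟨x, a • v⟩ ∧
      velocity VE (c ∘ χ) (χ ⁻¹' J) (a⁻¹ * s) = ⟨p, a • w⟩ := by
  intro χ
  have hχs : χ (a⁻¹ * s) = s := mul_inv_cancel_left₀ ha s
  have hχd : ContDiff ℝ 1 χ := contDiff_const.mul contDiff_id
  have hbij : BijOn χ (χ ⁻¹' J) J :=
    ⟨fun t ht ↦ ht, fun t _ t' _ e ↦ mul_left_cancel₀ ha e,
      fun t ht ↦ ⟨a⁻¹ * t, by simpa [χ, mul_inv_cancel_left₀ ha] using ht,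
        mul_inv_cancel_left₀ ha t⟩⟩
  have hoc : (χ ⁻¹' J).OrdConnected := h.ordConnected.preimage_mul_left a
  have hn : (χ ⁻¹' J).Nontrivial := by
    refine nontrivial_of_image χ _ ?_
    rwa [hbij.image_eq]
  have hu := hoc.uniqueDiffOn_real hn
  have hder : ∀ t ∈ χ ⁻¹' J, derivWithin χ (χ ⁻¹' J) t = a := fun t ht ↦ by
    have : HasDerivAt χ a t := by simpa using (hasDerivAt_id t).const_mul a
    exact this.hasDerivWithinAt.derivWithin (hu t ht)
  have hp := h.comp_bijOn hbij hχd.contDiffOn hoc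
  have hc' := hΛ.reparam h hp hbij hχd.contDiffOn (fun t ht ↦ by rwa [hder t ht]) hc
  have hmem : a⁻¹ * s ∈ χ ⁻¹' J := by rw [mem_preimage, hχs]; exact hs
  refine ⟨hp, hc', hn, ?_, ?_⟩
  · refine Eq.trans ?_ (congrArg (fun r : ℝ ↦ (⟨x, r • v⟩ : TangentBundle 𝓘(ℝ, VM) M)) (hder _ hmem))
    exact velocity_comp_eq hmem hu hbij.mapsTo (hχd.differentiable one_ne_zero _).differentiableWithinAt
      (h.contMDiffOn.mdiffWithinAt (by rwa [hχs])) (by rw [hχs, hv])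
  · refine Eq.trans ?_ (congrArg (fun r : ℝ ↦ (⟨p, r • w⟩ : TangentBundle 𝓘(ℝ, VE) E)) (hder _ hmem))
    exact velocity_comp_eq hmem hu hbij.mapsTo (hχd.differentiable one_ne_zero _).differentiableWithinAt
      ((hΛ.contMDiffOn h hc).mdiffWithinAt (by rwa [hχs])) (by rw [hχs, hw])

/-- Homogeneity of lifting comes from the linear change of parameter `t ↦ a * t`. Negative `a` is
allowed because rules respect both orientations; `a = 0` is not a diffeomorphism and needs the
uniqueness of velocities. -/
theorem RuleVelocity.smul (hΛ : IsLiftRule VM VE π Λ) {p : E}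
    {v : TangentSpace 𝓘(ℝ, VM) (π p)} {w : TangentSpace 𝓘(ℝ, VE) p}
    (h : RuleVelocity VM VE π Λ p v w) {a : ℝ} (ha : a ≠ 0) :
    RuleVelocity VM VE π Λ p (a • v) (a • w) := by
  obtain ⟨γ, J, c, s, hγ, hc, hs, hcs, hJ, hv, hw⟩ := h
  obtain ⟨h1, h2, h3, h4, h5⟩ := hΛ.scale hγ hc hs hJ hv hw ha
  refine ⟨_, _, _, a⁻¹ * s, h1, h2, ?_, ?_, h3, h4, h5⟩
  · rwa [mem_preimage, mul_inv_cancel_left₀ ha]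
  · rw [Function.comp, mul_inv_cancel_left₀ ha, hcs]

theorem PathMapping.IsGovernedBy.ruleVelocity {P : PathMapping VM π} (hP : P.IsGovernedBy Λ)
    (hΛ : IsLiftRule VM VE π Λ) {p : E} {v : TangentSpace 𝓘(ℝ, VM) (π p)}
    {w : TangentSpace 𝓘(ℝ, VE) p} (h : P.IsLiftVelocity VE p v w) :
    RuleVelocity VM VE π Λ p v w := by
  obtain ⟨γ, a, b, h, hp, hab, hv, hw⟩ := h
  have ha : a ∈ Icc a b := left_mem_Icc.2 hab.le
  obtain ⟨c, hc, hcs⟩ := hΛ.exists_lift h a ha p hp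
  refine ⟨γ, Icc a b, c, a, h, hc, ha, hcs, ⟨a, ha, b, right_mem_Icc.2 hab.le, hab.ne⟩, hv, ?_⟩
  rw [← hw]
  exact (velocity_congr (hP.eqOn_lift hΛ h hc ⟨p, hp⟩ hcs) ha).symm

/-- The velocity of a lift at a point which is not the right end-point of the path is the initial
velocity of a lift. -/
theorem PathMapping.IsGovernedBy.isLiftVelocity_of_lt {P : PathMapping VM π}
    (hP : P.IsGovernedBy Λ) (hΛ : IsLiftRule VM VE π Λ) {γ : ℝ → M} {J : Set ℝ} {c : ℝ → E}
    {s b : ℝ} (h : IsPath VM γ J) (hc : Λ γ J c) (hs : s ∈ J) (hb : b ∈ J) (hsb : s < b)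
    {p : E} (hcs : c s = p) {v : TangentSpace 𝓘(ℝ, VM) (π p)} {w : TangentSpace 𝓘(ℝ, VE) p}
    (hv : velocity VM γ J s = ⟨π p, v⟩) (hw : velocity VE c J s = ⟨p, w⟩) :
    P.IsLiftVelocity VE p v w := by
  have hsub : Icc s b ⊆ J := h.ordConnected.out hs hb
  have hI : IsPath VM γ (Icc s b) := h.mono hsub (nonempty_Icc.2 hsb.le) ordConnected_Icc
  have hp : π p = γ s := by rw [← hcs]; exact hΛ.proj hc s hs
  have hu := uniqueDiffOn_Icc hsb
  have hmem : s ∈ Icc s b := left_mem_Icc.2 hsb.le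
  refine ⟨γ, s, b, hI, hp, hsb, ?_, ?_⟩
  · rw [velocity_mono hsub hmem hu (h.contMDiffOn.mdiffWithinAt hs), hv]
  · rw [velocity_congr (hP.eqOn_lift hΛ hI (hΛ.mono h hc hsub hI) ⟨p, hp⟩ hcs) hmem,
      velocity_mono hsub hmem hu ((hΛ.contMDiffOn h hc).mdiffWithinAt hs), hw]

/-- The interval must be nondegenerate: on a one-point interval the derivative within it is zero by
default, and the reflection would not count as a diffeomorphism. -/
theorem IsLiftRule.reverse (hΛ : IsLiftRule VM VE π Λ) {γ : ℝ → M} {a b : ℝ} {c : ℝ → E}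
    (h : IsPath VM γ (Icc a b)) (hc : Λ γ (Icc a b) c) (hab : a < b) :
    Λ (fun t ↦ γ (a + b - t)) (Icc a b) (fun t ↦ c (a + b - t)) := by
  have hd : ContDiffOn ℝ 1 (fun t ↦ a + b - t) (Icc a b) :=
    (contDiff_const.sub contDiff_id).contDiffOn
  refine hΛ.reparam h (h.comp_bijOn (bijOn_Icc_sub a b) hd ordConnected_Icc) (bijOn_Icc_sub a b)
    hd (fun t ht ↦ ?_) hc
  have : HasDerivAt (fun t ↦ a + b - t) (-1) t := by
    simpa using (hasDerivAt_id t).const_sub (a + b)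
  rw [this.hasDerivWithinAt.derivWithin (uniqueDiffOn_Icc hab t ht)]
  norm_num

/-! ### The lifts of a regular transport along paths -/

/-- `c` is a lift of `γ : J → M` with respect to `T`. -/
def TransportAlongPaths.IsLift (T : TransportAlongPaths VM π) (γ : ℝ → M) (J : Set ℝ)
    (c : ℝ → E) : Prop :=
  ∃ hp : ∀ t ∈ J, π (c t) = γ t, ∀ (h : IsPath VM γ J) (s t : ℝ) (hs : s ∈ J) (ht : t ∈ J),
    (T.map γ J h s t hs ht ⟨c s, hp s hs⟩ : E) = c t

theorem TransportAlongPaths.isLift_lift (T : TransportAlongPaths VM π) {γ : ℝ → M} {J : Set ℝ}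
    (h : IsPath VM γ J) {s : ℝ} (hs : s ∈ J) (p : Fibre π (γ s)) :
    T.IsLift γ J (T.lift γ J h s hs p) := by
  have hval : ∀ t (ht : t ∈ J), T.lift γ J h s hs p t = T.map γ J h s t hs ht p :=
    fun t ht ↦ dif_pos ht
  refine ⟨fun t ht ↦ by rw [hval t ht]; exact (T.map γ J h s t hs ht p).2, fun h' r t hr ht ↦ ?_⟩
  rw [hval t ht, ← T.map_comp γ J h s r t hs hr ht]
  congr 2
  exact Subtype.ext (hval r hr)

theorem TransportAlongPaths.lift_self (T : TransportAlongPaths VM π) {γ : ℝ → M} {J : Set ℝ}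
    (h : IsPath VM γ J) {s : ℝ} (hs : s ∈ J) (p : Fibre π (γ s)) :
    T.lift γ J h s hs p s = p := by
  rw [TransportAlongPaths.lift, dif_pos hs, T.map_self]
  rfl

theorem TransportAlongPaths.IsLift.eqOn_lift {T : TransportAlongPaths VM π} {γ : ℝ → M}
    {J : Set ℝ} {c : ℝ → E} (hc : T.IsLift γ J c) (h : IsPath VM γ J) {s : ℝ} (hs : s ∈ J)
    (p : Fibre π (γ s)) (hp : c s = p) : EqOn c (T.lift γ J h s hs p) J := by
  obtain ⟨p, hp'⟩ := p
  obtain rfl : c s = p := hp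
  intro t ht
  rw [TransportAlongPaths.lift, dif_pos ht]
  exact (hc.2 h s t hs ht).symm

theorem TransportAlongPaths.isGovernedBy_isLift (T : TransportAlongPaths VM π) :
    T.IsGovernedBy T.IsLift :=
  fun γ J h s t hs ht p ↦ ⟨_, T.isLift_lift h hs p, T.lift_self h hs p,
    by rw [TransportAlongPaths.lift, dif_pos ht]⟩

variable [IsManifold 𝓘(ℝ, VM) 1 M] [IsManifold 𝓘(ℝ, VE) 1 E] {k : ℕ∞}

/-- A velocity of the rule may be taken at a right end-point, where it is not visibly an initial
velocity. Regularity allows the path to be replaced by a chart line with the same velocity, which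
extends to both sides. -/
theorem PathMapping.IsGovernedBy.isLiftVelocity_iff {P : PathMapping VM π}
    (hP : P.IsGovernedBy Λ) (hΛ : IsRegularLiftRule VM VE k π Λ) {p : E}
    {v : TangentSpace 𝓘(ℝ, VM) (π p)} {w : TangentSpace 𝓘(ℝ, VE) p} :
    P.IsLiftVelocity VE p v w ↔ RuleVelocity VM VE π Λ p v w := by
  refine ⟨hP.ruleVelocity hΛ.toIsLiftRule, fun h ↦ ?_⟩
  obtain ⟨γ, ε, c, w', hε, hγ, hc, hc0, hv, hw, -⟩ := hΛ.exists_velocity p v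
  have h1 : P.IsLiftVelocity VE p v w' := hP.isLiftVelocity_of_lt hΛ.toIsLiftRule hγ hc
    ⟨by linarith, hε.le⟩ (right_mem_Icc.2 (by linarith)) hε hc0 hv hw
  rwa [hΛ.velocity_unique p v w w' h (hP.ruleVelocity hΛ.toIsLiftRule h1)]

theorem PathMapping.IsGovernedBy.liftVelocities_eq {P : PathMapping VM π}
    (hP : P.IsGovernedBy Λ) (hΛ : IsRegularLiftRule VM VE k π Λ) (p : E) :
    P.liftVelocities VE p = {w | ∃ v, RuleVelocity VM VE π Λ p v w} := by
  ext w
  exact exists_congr fun v ↦ hP.isLiftVelocity_iff hΛ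

theorem PathMapping.IsGovernedBy.isParallelTransport {P : PathMapping VM π}
    (hP : P.IsGovernedBy Λ) (hΛ : IsRegularLiftRule VM VE k π Λ) : P.IsParallelTransport VE k where
  map_self γ a h := by
    funext p
    obtain ⟨c, hc, hca⟩ := hΛ.exists_lift h a (left_mem_Icc.2 le_rfl) p p.2
    exact Subtype.ext ((hP.map_eq hΛ.toIsLiftRule h hc p hca).trans hca)
  map_comp γ a b d hab hbd had := by
    funext p
    obtain ⟨c, hc, hca⟩ := hΛ.exists_lift had a (left_mem_Icc.2 had.le) p p.2
    refine Subtype.ext ?_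
    rw [hP.map_eq hΛ.toIsLiftRule had hc p hca]
    refine hP.map_eq hΛ.toIsLiftRule hbd (hΛ.mono had hc (Icc_subset_Icc_left hab.le) hbd) _ ?_
    exact (hP.map_eq hΛ.toIsLiftRule hab
      (hΛ.mono had hc (Icc_subset_Icc_right hbd.le) hab) p hca).symm
  map_inv γ a b h h' p q hp hq := by
    have hq' : π q = γ b := by rw [hq, add_sub_cancel_left]
    -- For `a < b` the reversed lift through `q` is compared with the lift through `p`; one-point
    -- paths, where reversal is not available, transport by the identity.
    rcases h.le.lt_or_eq with hab | rfl
    · have hb : b ∈ Icc a b := right_mem_Icc.2 hab.le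
      have ha : a ∈ Icc a b := left_mem_Icc.2 hab.le
      obtain ⟨c, hc, hcb⟩ := hΛ.exists_lift h b hb q hq'
      have h1 := hP.map_eq hΛ.toIsLiftRule h' (hΛ.reverse h hc hab) ⟨q, hq⟩
        ((congrArg c (add_sub_cancel_left a b)).trans hcb)
      rw [h1, add_sub_cancel_right]
      constructor
      · intro e
        obtain ⟨c', hc', hca'⟩ := hΛ.exists_lift h a ha p hp
        have h2 := hP.map_eq hΛ.toIsLiftRule h hc' ⟨p, hp⟩ hca'
        rw [hΛ.unique h hc hc' b hb (by rw [hcb, ← e, h2]) ha, hca']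
      · intro e
        rw [hP.map_eq hΛ.toIsLiftRule h hc ⟨p, hp⟩ e, hcb]
    · have hself : ∀ (δ : ℝ → M) (hδ : IsPath VM δ (Icc a a)) (r : E) (hr : π r = δ a),
          (P.map δ a a hδ ⟨r, hr⟩ : E) = r := fun δ hδ r hr ↦ by
        obtain ⟨c, hc, hca⟩ := hΛ.exists_lift hδ a (left_mem_Icc.2 le_rfl) r hr
        exact (hP.map_eq hΛ.toIsLiftRule hδ hc ⟨r, hr⟩ hca).trans hca
      rw [hself, hself]
      exact eq_comm
  reparam γ a b χ h h' hd hpos := by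
    have hbij := bijOn_Icc_of_derivWithin_pos hd h'.le hpos
    funext p
    obtain ⟨c, hc, hcs⟩ := hΛ.exists_lift h (χ a) (left_mem_Icc.2 h.le) p p.2
    refine Subtype.ext ?_
    refine (hP.map_eq hΛ.toIsLiftRule h'
      (hΛ.reparam h h' hbij hd (fun t ht ↦ (hpos t ht).ne') hc) p hcs).trans ?_
    exact (hP.map_eq hΛ.toIsLiftRule h hc p hcs).symm
  contMDiffOn_lift γ a b h p := by
    obtain ⟨c, hc, hcs⟩ := hΛ.exists_lift h a (left_mem_Icc.2 h.le) p p.2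
    exact (hΛ.contMDiffOn h hc).congr (hP.eqOn_lift hΛ.toIsLiftRule h hc p hcs)
  velocity_unique p v w w' hw hw' :=
    hΛ.velocity_unique p v w w' ((hP.isLiftVelocity_iff hΛ).1 hw)
      ((hP.isLiftVelocity_iff hΛ).1 hw')
  smooth U X Y hU hX hY :=
    hΛ.smooth U X Y hU hX fun p hp ↦ (hP.isLiftVelocity_iff hΛ).1 (hY p hp)

theorem TransportAlongPaths.IsRegular.isLiftRule {T : TransportAlongPaths VM π}
    (hT : T.IsRegular VE k) : IsLiftRule VM VE π T.IsLift where
  proj hc := hc.1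
  congr {γ γ' J c} hγ hc e := by
    refine ⟨fun t ht ↦ (hc.1 t ht).trans (e ht), fun h' s t hs ht ↦ ?_⟩
    rw [← hc.2 hγ s t hs ht]
    exact (T.congr γ γ' J hγ h' e s t hs ht (c s) _ _).symm
  exists_lift h s hs p hp := ⟨_, T.isLift_lift h hs ⟨p, hp⟩, T.lift_self h hs ⟨p, hp⟩⟩
  unique {γ J c c'} h hc hc' s hs e := by
    have hp := hc'.1 s hs
    exact (hc.eqOn_lift h hs ⟨c' s, hp⟩ e).trans (hc'.eqOn_lift h hs ⟨c' s, hp⟩ rfl).symm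
  mono {γ J J' c} h hc hJ h' := by
    refine ⟨fun t ht ↦ hc.1 t (hJ ht), fun h'' s t hs ht ↦ ?_⟩
    rw [hT.locality γ J J' h h'' hJ s t hs ht]
    exact hc.2 h s t (hJ hs) (hJ ht)
  reparam {γ J J' c χ} h h' hχ hd hd' hc := by
    refine ⟨fun t ht ↦ hc.1 (χ t) (hχ.mapsTo ht), fun h'' s t hs ht ↦ ?_⟩
    rw [hT.reparam γ J J' χ h h'' hχ hd hd' s t hs ht]
    exact hc.2 h (χ s) (χ t) (hχ.mapsTo hs) (hχ.mapsTo ht)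
  contMDiffOn {γ J c} h hc := by
    obtain ⟨s, hs⟩ := h.nonempty
    exact (hT.contMDiffOn_lift γ J h s hs ⟨c s, hc.1 s hs⟩).congr
      (hc.eqOn_lift h hs ⟨c s, hc.1 s hs⟩ rfl)

theorem TransportAlongPaths.IsRegular.isRegularLiftRule {T : TransportAlongPaths VM π}
    (hT : T.IsRegular VE k) : IsRegularLiftRule VM VE k π T.IsLift where
  __ := hT.isLiftRule
  velocity_unique p v w w' hw hw' :=
    hT.velocity_unique p v w w' ((T.isGovernedBy_isLift.isLiftVelocity_iff hT.isLiftRule).2 hw)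
      ((T.isGovernedBy_isLift.isLiftVelocity_iff hT.isLiftRule).2 hw')
  smooth U X Y hU hX hY := hT.smooth U X Y hU hX fun p hp ↦
    (T.isGovernedBy_isLift.isLiftVelocity_iff hT.isLiftRule).2 (hY p hp)

end LiftRule

/-! ### The lifts of a parallel transport -/

namespace PathMapping

variable {VM : Type*} [NormedAddCommGroup VM] [NormedSpace ℝ VM]
  {M : Type*} [TopologicalSpace M] [ChartedSpace VM M]
  {VE : Type*} [NormedAddCommGroup VE] [NormedSpace ℝ VE]
  {E : Type*} [TopologicalSpace E] [ChartedSpace VE E]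
  {π : E → M} (P : PathMapping VM π)

/-- `P` maps `p` to `q` along `γ : [a, b] → M`. -/
def Rel (γ : ℝ → M) (a b : ℝ) (p q : E) : Prop :=
  ∃ (h : IsPath VM γ (Icc a b)) (hp : π p = γ a), (P.map γ a b h ⟨p, hp⟩ : E) = q

/-- `c` is a lift of `γ : J → M` with respect to `P`. -/
def IsLift (γ : ℝ → M) (J : Set ℝ) (c : ℝ → E) : Prop :=
  (∀ t ∈ J, π (c t) = γ t) ∧ ∀ a ∈ J, ∀ b ∈ J, a ≤ b → P.Rel γ a b (c a) (c b)

variable {P} {γ : ℝ → M} {a b d : ℝ} {p p' q q' r : E}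

theorem Rel.proj (h : P.Rel γ a b p q) : π q = γ b := by
  obtain ⟨h, hp, rfl⟩ := h
  exact (P.map γ a b h ⟨p, hp⟩).2

theorem Rel.eq_right (h : P.Rel γ a b p q) (h' : P.Rel γ a b p q') : q = q' := by
  obtain ⟨h, hp, rfl⟩ := h
  obtain ⟨h', hp', rfl⟩ := h'
  rfl

theorem Rel.congr {γ' : ℝ → M} (h : P.Rel γ a b p q) (e : EqOn γ γ' (Icc a b))
    (h' : IsPath VM γ' (Icc a b)) : P.Rel γ' a b p q := by
  obtain ⟨h, hp, rfl⟩ := h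
  exact ⟨h', hp.trans (e (left_mem_Icc.2 h.le)), (P.congr γ γ' a b h h' e p hp _).symm⟩

theorem exists_rel (h : IsPath VM γ (Icc a b)) (hp : π p = γ a) : ∃ q, P.Rel γ a b p q :=
  ⟨_, h, hp, rfl⟩

variable [IsManifold 𝓘(ℝ, VM) 1 M] [IsManifold 𝓘(ℝ, VE) 1 E] {k : ℕ∞}

namespace IsParallelTransport

variable (hP : P.IsParallelTransport VE k)
include hP

theorem rel_self (h : IsPath VM γ (Icc a a)) (hp : π p = γ a) : P.Rel γ a a p p :=
  ⟨h, hp, by rw [hP.map_self]; rfl⟩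

theorem rel_trans (h : P.Rel γ a b p q) (h' : P.Rel γ b d q r) (had : IsPath VM γ (Icc a d)) :
    P.Rel γ a d p r := by
  obtain ⟨h, hp, rfl⟩ := h
  obtain ⟨h', hq, rfl⟩ := h'
  refine ⟨had, hp, ?_⟩
  rw [← hP.map_comp γ a b d h h' had]
  rfl

theorem isPath_reverse (h : IsPath VM γ (Icc a b)) :
    IsPath VM (fun t ↦ γ (a + b - t)) (Icc a b) :=
  h.comp_bijOn (bijOn_Icc_sub a b) (contDiff_const.sub contDiff_id).contDiffOn ordConnected_Icc

theorem rel_reverse (h : P.Rel γ a b p q) : P.Rel (fun t ↦ γ (a + b - t)) a b q p := by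
  have hq := h.proj
  obtain ⟨h, hp, e⟩ := h
  have hq' : π q = γ (a + b - a) := by rw [hq, add_sub_cancel_left]
  exact ⟨hP.isPath_reverse h, hq', (hP.map_inv γ a b h (hP.isPath_reverse h) p q hp hq').1 e⟩

/-- Injectivity of the transport maps: the reversed path carries the common image back to both
points. -/
theorem eq_left (h : P.Rel γ a b p q) (h' : P.Rel γ a b p' q) : p = p' :=
  (hP.rel_reverse h).eq_right (hP.rel_reverse h')

theorem exists_rel_left (h : IsPath VM γ (Icc a b)) (hq : π q = γ b) : ∃ p, P.Rel γ a b p q := by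
  have hq' : π q = γ (a + b - a) := by rw [hq, add_sub_cancel_left]
  obtain ⟨p, hp⟩ := exists_rel (P := P) (hP.isPath_reverse h) hq'
  have := hP.rel_reverse hp
  -- Reversing twice gives back `γ`.
  simp only [sub_sub_cancel] at this
  exact ⟨p, this⟩

theorem rel_comp_of_pos {χ : ℝ → ℝ} {a' b' : ℝ} (hab : a ≤ b) (hd : ContDiffOn ℝ 1 χ (Icc a b))
    (hpos : ∀ t ∈ Icc a b, 0 < derivWithin χ (Icc a b) t) (ha : χ a = a') (hb : χ b = b')
    (h : P.Rel γ a' b' p q) : P.Rel (γ ∘ χ) a b p q := by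
  subst ha hb
  obtain ⟨h, hp, rfl⟩ := h
  have h' := h.comp_bijOn (bijOn_Icc_of_derivWithin_pos hd hab hpos) hd ordConnected_Icc
  refine ⟨h', hp, ?_⟩
  rw [hP.reparam γ a b χ h h' hd hpos]

/-- The reversed path lives on `[a, b]`; translating its parameter by `a + b` moves it to `[-b,
-a]`. This reduces a decreasing `χ` to the increasing `-χ`. -/
theorem rel_neg (hab : a < b) (h : P.Rel γ a b p q) : P.Rel (fun t ↦ γ (-t)) (-b) (-a) q p := by
  have hder : ∀ t, HasDerivAt (fun t ↦ t + (a + b)) 1 t := fun t ↦ (hasDerivAt_id t).add_const _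
  have hab' : -b < -a := neg_lt_neg hab
  have h1 := hP.rel_comp_of_pos (χ := fun t ↦ t + (a + b)) hab'.le
    (contDiff_id.add contDiff_const).contDiffOn (fun t ht ↦ by
      rw [(hder t).hasDerivWithinAt.derivWithin (uniqueDiffOn_Icc hab' t ht)]
      exact one_pos) (show -b + (a + b) = a by ring) (show -a + (a + b) = b by ring)
    (hP.rel_reverse h)
  convert h1 using 1
  funext t
  simp

theorem rel_comp_of_neg {χ : ℝ → ℝ} (hab : a < b) (hd : ContDiffOn ℝ 1 χ (Icc a b))
    (hneg : ∀ t ∈ Icc a b, derivWithin χ (Icc a b) t < 0)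
    (h : P.Rel γ (χ b) (χ a) p q) : P.Rel (γ ∘ χ) a b q p := by
  have hpos : ∀ t ∈ Icc a b, 0 < derivWithin (fun t ↦ -χ t) (Icc a b) t := fun t ht ↦ by
    rw [derivWithin.fun_neg]
    exact neg_pos.2 (hneg t ht)
  have hlt : χ b < χ a := by
    have hb := (bijOn_Icc_of_derivWithin_pos hd.neg hab.le hpos)
    have ha : a ∈ Icc a b := left_mem_Icc.2 hab.le
    have hb' : b ∈ Icc a b := right_mem_Icc.2 hab.le
    refine lt_of_le_of_ne (neg_le_neg_iff.1 (hb.mapsTo ha).2) fun e ↦ hab.ne ?_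
    exact hb.injOn ha hb' (congrArg Neg.neg e.symm)
  have h1 := hP.rel_comp_of_pos hab.le hd.neg hpos rfl rfl (hP.rel_neg hlt h)
  convert h1 using 1
  funext t
  simp

/-- To the right of `s` the lift is the image of `p`, to the left its preimage. Compatibility on
`[a, b]` depends on the position of `s` relative to `a` and `b`. -/
theorem exists_isLift {J : Set ℝ} (h : IsPath VM γ J) {s : ℝ} (hs : s ∈ J) (hp : π p = γ s) :
    ∃ c, P.IsLift γ J c ∧ c s = p := by
  have hI : ∀ {x y : ℝ}, x ∈ J → y ∈ J → x ≤ y → IsPath VM γ (Icc x y) := fun hx hy hxy ↦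
    h.mono (h.ordConnected.out hx hy) (nonempty_Icc.2 hxy) ordConnected_Icc
  have hex : ∀ t ∈ J, ∃ q, π q = γ t ∧ (s ≤ t → P.Rel γ s t p q) ∧
      (t ≤ s → P.Rel γ t s q p) := fun t ht ↦ by
    rcases lt_trichotomy s t with hst | rfl | hst
    · obtain ⟨q, hq⟩ := exists_rel (P := P) (hI hs ht hst.le) hp
      exact ⟨q, hq.proj, fun _ ↦ hq, fun h ↦ absurd h hst.not_ge⟩
    · exact ⟨p, hp, fun h ↦ hP.rel_self (hI hs hs h) hp, fun h ↦ hP.rel_self (hI hs hs h) hp⟩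
    · obtain ⟨q, hq⟩ := hP.exists_rel_left (hI ht hs hst.le) hp
      exact ⟨q, hq.2.1, fun h ↦ absurd h hst.not_ge, fun _ ↦ hq⟩
  have : Nonempty E := ⟨p⟩
  choose! c hc1 hc2 hc3 using hex
  refine ⟨c, ⟨hc1, fun a ha b hb hab ↦ ?_⟩, ?_⟩
  · obtain ⟨q, hq⟩ := exists_rel (P := P) (hI ha hb hab) (hc1 a ha)
    suffices hqb : q = c b by rwa [← hqb]
    rcases le_total s a with hsa | hsa
    · exact (hP.rel_trans (hc2 a ha hsa) hq (hI hs hb (hsa.trans hab))).eq_right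
        (hc2 b hb (hsa.trans hab))
    · rcases le_total s b with hsb | hsb
      · exact hq.eq_right (hP.rel_trans (hc3 a ha hsa) (hc2 b hb hsb) (hI ha hb hab))
      -- Here `a ≤ b ≤ s`: transporting from `b` to `s` takes both `q` and `c b` to `p`, so they
      -- agree by injectivity.
      · obtain ⟨r, hr⟩ := exists_rel (P := P) (hI hb hs hsb) hq.proj
        obtain rfl : r = p := (hP.rel_trans hq hr (hI ha hs hsa)).eq_right (hc3 a ha hsa)
        exact hP.eq_left hr (hc3 b hb hsb)
  · exact (hc2 s hs le_rfl).eq_right (hP.rel_self (hI hs hs le_rfl) hp)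

theorem eqOn_lift_of_isLift {c : ℝ → E} (h : IsPath VM γ (Icc a b)) (hc : P.IsLift γ (Icc a b) c)
    (q : Fibre π (γ a)) (hq : c a = q) : EqOn c (P.lift γ a b h q) (Icc a b) := by
  obtain ⟨q, hq'⟩ := q
  obtain rfl : c a = q := hq
  intro t ht
  rw [PathMapping.lift, dif_pos ht]
  exact (hc.2 a (left_mem_Icc.2 h.le) t ht ht.1).eq_right ⟨h.Icc_initial ht, hq', rfl⟩

theorem isLiftRule : IsLiftRule VM VE π P.IsLift where
  proj hc := hc.1
  congr {γ γ' J c} hγ hc e := by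
    refine ⟨fun t ht ↦ (hc.1 t ht).trans (e ht), fun a ha b hb hab ↦ ?_⟩
    have hsub := hγ.ordConnected.out ha hb
    refine (hc.2 a ha b hb hab).congr (e.mono hsub) ⟨nonempty_Icc.2 hab, ordConnected_Icc, ?_⟩
    exact (hγ.contMDiffOn.mono hsub).congr fun t ht ↦ (e (hsub ht)).symm
  exists_lift h s hs p hp := hP.exists_isLift h hs hp
  unique {γ J c c'} h hc hc' s hs e t ht := by
    rcases le_total s t with hst | hst
    · exact (hc.2 s hs t ht hst).eq_right (e ▸ hc'.2 s hs t ht hst)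
    · exact hP.eq_left (hc.2 t ht s hs hst) (e ▸ hc'.2 t ht s hs hst)
  mono h hc hJ h' := ⟨fun t ht ↦ hc.1 t (hJ ht), fun a ha b hb ↦ hc.2 a (hJ ha) b (hJ hb)⟩
  reparam {γ J J' c χ} h h' hχ hd hd' hc := by
    refine ⟨fun t ht ↦ hc.1 (χ t) (hχ.mapsTo ht), fun a ha b hb hab ↦ ?_⟩
    have hsub := h'.ordConnected.out ha hb
    rcases hab.lt_or_eq with hab' | rfl
    · have hu := uniqueDiffOn_Icc hab'
      have hdI := hd.mono hsub
      have hder : ∀ t ∈ Icc a b, HasDerivWithinAt χ (derivWithin χ (Icc a b) t) (Icc a b) t :=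
        fun t ht ↦ (hdI.differentiableOn one_ne_zero t ht).hasDerivWithinAt
      have hne : ∀ t ∈ Icc a b, derivWithin χ (Icc a b) t ≠ 0 := fun t ht ↦ by
        rw [derivWithin_subset hsub (hu t ht) (hd.differentiableOn one_ne_zero t (hsub ht))]
        exact hd' t (hsub ht)
      -- By Darboux's theorem a nowhere zero derivative has constant sign, so `χ` is increasing or
      -- decreasing.
      rcases hasDerivWithinAt_forall_lt_or_forall_gt_of_forall_ne (convex_Icc a b) hder hne
        with hneg | hpos
      · have hle : χ b ≤ χ a := by
          have hpos : ∀ t ∈ Icc a b, 0 < derivWithin (fun t ↦ -χ t) (Icc a b) t := fun t ht ↦ by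
            rw [derivWithin.fun_neg]
            exact neg_pos.2 (hneg t ht)
          exact neg_le_neg_iff.1
            ((bijOn_Icc_of_derivWithin_pos hdI.neg hab hpos).mapsTo (left_mem_Icc.2 hab)).2
        exact hP.rel_comp_of_neg hab' hdI hneg
          (hc.2 (χ b) (hχ.mapsTo hb) (χ a) (hχ.mapsTo ha) hle)
      · have hle : χ a ≤ χ b :=
          ((bijOn_Icc_of_derivWithin_pos hdI hab hpos).mapsTo (left_mem_Icc.2 hab)).2
        exact hP.rel_comp_of_pos hab hdI hpos rfl rfl
          (hc.2 (χ a) (hχ.mapsTo ha) (χ b) (hχ.mapsTo hb) hle)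
    · exact hP.rel_self (h'.mono hsub (nonempty_Icc.2 le_rfl) ordConnected_Icc)
        (hc.1 (χ a) (hχ.mapsTo ha))
  contMDiffOn {γ J c} h hc := by
    refine contMDiffOn_of_forall_Icc fun a ha b hb hab ↦ ?_
    have hsub := h.ordConnected.out ha hb
    have hI : IsPath VM γ (Icc a b) := h.mono hsub (nonempty_Icc.2 hab) ordConnected_Icc
    refine (hP.contMDiffOn_lift γ a b hI ⟨c a, hc.1 a ha⟩).congr ?_
    exact hP.eqOn_lift_of_isLift hI
      ⟨fun t ht ↦ hc.1 t (hsub ht), fun x hx y hy ↦ hc.2 x (hsub hx) y (hsub hy)⟩ _ rfl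

theorem isGovernedBy : P.IsGovernedBy P.IsLift := by
  intro γ a b h p
  obtain ⟨c, hc, hca⟩ := hP.exists_isLift h (left_mem_Icc.2 h.le) p.2
  refine ⟨c, hc, hca, ?_⟩
  have := hc.2 a (left_mem_Icc.2 h.le) b (right_mem_Icc.2 h.le) h.le
  rw [hca] at this
  exact Rel.eq_right ⟨h, p.2, rfl⟩ this

/-- There is a point of `J` on at least one side of `s`. If it lies to the left, the reflection `t ↦
-t` brings it to the right, at the cost of a sign on both velocities. -/
theorem isLiftVelocity_or {v : TangentSpace 𝓘(ℝ, VM) (π p)} {w : TangentSpace 𝓘(ℝ, VE) p}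
    (h : RuleVelocity VM VE π P.IsLift p v w) :
    P.IsLiftVelocity VE p v w ∨ P.IsLiftVelocity VE p ((-1 : ℝ) • v) ((-1 : ℝ) • w) := by
  obtain ⟨γ, J, c, s, hγ, hc, hs, hcs, hJ, hv, hw⟩ := h
  obtain ⟨b, hb, hbs⟩ := hJ.exists_ne s
  rcases lt_or_gt_of_ne hbs with hlt | hlt
  · right
    obtain ⟨h1, h2, h3, h4, h5⟩ :=
      hP.isLiftRule.scale hγ hc hs hJ hv hw (a := -1) (by norm_num)
    refine hP.isGovernedBy.isLiftVelocity_of_lt hP.isLiftRule h1 h2 (b := -b) ?_ ?_ ?_ ?_ h4 h5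
    · simpa using hs
    · simpa using hb
    · norm_num; exact hlt
    · simpa using hcs
  · left
    exact hP.isGovernedBy.isLiftVelocity_of_lt hP.isLiftRule hγ hc hs hb hlt hcs hv hw

/-- Removes the sign: a chart line through `π p` with velocity `v` has a lift on both sides, with
velocity `w'`. Run forwards, it shows `w'` to be an initial velocity over `v`; run backwards, it
does so for `-w'` over `-v`. Uniqueness of initial velocities over `-v` forces `w = w'`. -/
theorem isLiftVelocity_of_ruleVelocity {v : TangentSpace 𝓘(ℝ, VM) (π p)}
    {w : TangentSpace 𝓘(ℝ, VE) p} (h : RuleVelocity VM VE π P.IsLift p v w) :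
    P.IsLiftVelocity VE p v w := by
  rcases hP.isLiftVelocity_or h with h | h
  · exact h
  · obtain ⟨γ, ε, c, w', hε, hγ, hc, hc0, hv, hw, -⟩ := hP.isLiftRule.exists_velocity p v
    have h0 : (0 : ℝ) ∈ Icc (-ε) ε := ⟨by linarith, hε.le⟩
    have h1 := hP.isGovernedBy.isLiftVelocity_of_lt hP.isLiftRule hγ hc h0
      (right_mem_Icc.2 (by linarith)) hε hc0 hv hw
    obtain ⟨g1, g2, g3, g4, g5⟩ := hP.isLiftRule.scale hγ hc h0
      ⟨_, left_mem_Icc.2 (by linarith), _, right_mem_Icc.2 (by linarith), by linarith⟩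
      hv hw (a := -1) (by norm_num)
    rw [mul_zero] at g4 g5
    have h2 := hP.isGovernedBy.isLiftVelocity_of_lt hP.isLiftRule g1 g2 (b := ε)
      (by simpa using h0) (by simpa using (by linarith : -ε ≤ ε)) hε (by simpa using hc0) g4 g5
    have h3 := hP.velocity_unique _ _ _ _ h h2
    have : w = w' := smul_right_injective _ (by norm_num : (-1 : ℝ) ≠ 0) h3
    rwa [this]

theorem isRegularLiftRule : IsRegularLiftRule VM VE k π P.IsLift where
  __ := hP.isLiftRule
  velocity_unique p v w w' hw hw' := hP.velocity_unique p v w w'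
    (hP.isLiftVelocity_of_ruleVelocity hw) (hP.isLiftVelocity_of_ruleVelocity hw')
  smooth U X Y hU hX hY := hP.smooth U X Y hU hX fun p hp ↦
    hP.isLiftVelocity_of_ruleVelocity (hY p hp)

end IsParallelTransport

end PathMapping

/-! ### Derivatives along paths and vector fields with given coordinates. -/

section Auxiliary

variable {V : Type*} [NormedAddCommGroup V] [NormedSpace ℝ V]
  {N : Type*} [TopologicalSpace N] [ChartedSpace V N]

theorem hasDerivWithinAt_comp_velocity {F : Type*} [NormedAddCommGroup F] [NormedSpace ℝ F]
    {f : N → F} {c : ℝ → N} {J : Set ℝ} {t : ℝ} {p : N} {w : TangentSpace 𝓘(ℝ, V) p}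
    (hf : MDifferentiableAt 𝓘(ℝ, V) 𝓘(ℝ, F) f p)
    (hc : MDifferentiableWithinAt 𝓘(ℝ, ℝ) 𝓘(ℝ, V) c J t) (hw : velocity V c J t = ⟨p, w⟩) :
    HasDerivWithinAt (f ∘ c) (mfderiv 𝓘(ℝ, V) 𝓘(ℝ, F) f p w : F) J t := by
  obtain rfl : c t = p := congrArg Bundle.TotalSpace.proj hw
  obtain rfl := Bundle.TotalSpace.mk_inj.1 hw
  have h1 := hf.hasMFDerivAt.comp_hasMFDerivWithinAt t hc.hasMFDerivWithinAt
  rw [hasMFDerivWithinAt_iff_hasFDerivWithinAt] at h1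
  have h2 : HasFDerivWithinAt (f ∘ c) ((mfderiv 𝓘(ℝ, V) 𝓘(ℝ, F) f (c t) ∘L
      mfderivWithin 𝓘(ℝ, ℝ) 𝓘(ℝ, V) c J t : ℝ →L[ℝ] F)) J t := h1
  have h3 : HasDerivWithinAt (f ∘ c) ((mfderiv 𝓘(ℝ, V) 𝓘(ℝ, F) f (c t) ∘L
      mfderivWithin 𝓘(ℝ, ℝ) 𝓘(ℝ, V) c J t : ℝ →L[ℝ] F) 1) J t := h2.hasDerivWithinAt
  exact h3

/-- The difference quotient at `0` is `h s` itself, so continuity of `h` suffices. This matters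
because the factor arising below is only known to be continuous. -/
theorem hasDerivWithinAt_id_smul {F : Type*} [NormedAddCommGroup F] [NormedSpace ℝ F]
    {h : ℝ → F} {J : Set ℝ} (hh : ContinuousWithinAt h J 0) :
    HasDerivWithinAt (fun s ↦ s • h s) (h 0) J 0 := by
  rw [hasDerivWithinAt_iff_tendsto_slope]
  refine (hh.mono_left (nhdsWithin_mono _ sdiff_subset)).congr' ?_
  filter_upwards [self_mem_nhdsWithin] with s hs
  have : s ≠ 0 := hs.2
  rw [slope_def_module]
  simp [smul_smul, this]

variable [IsManifold 𝓘(ℝ, V) 1 N]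

/-- Supplies the test fields for the smoothness axiom; the tangent bundle of a `C^{k+1}` manifold is
a `C^k` bundle. -/
theorem isVectorFieldOn_tangentOfCoord {k : ℕ∞} [IsManifold 𝓘(ℝ, V) (k + 1) N] (x₀ : N)
    {f : N → V} (hf : ContMDiffOn 𝓘(ℝ, V) 𝓘(ℝ, V) k f (chartAt V x₀).source) :
    IsVectorFieldOn V k (fun x ↦ tangentOfCoord x₀ x (f x)) (chartAt V x₀).source := by
  have : ContMDiffVectorBundle (k : WithTop ℕ∞) V (TangentSpace 𝓘(ℝ, V) : N → Type _) 𝓘(ℝ, V) :=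
    TangentBundle.contMDiffVectorBundle
  have hb : (trivializationAt V (TangentSpace 𝓘(ℝ, V)) x₀).baseSet = (chartAt V x₀).source := by
    simp
  have h1 := (trivializationAt V (TangentSpace 𝓘(ℝ, V)) x₀).contMDiffOn_section_baseSet_iff
    (n := (k : WithTop ℕ∞)) (IB := 𝓘(ℝ, V)) (s := fun x ↦ tangentOfCoord x₀ x (f x))
  rw [hb] at h1
  refine h1.2 (hf.congr fun x hx ↦ ?_)
  rw [trivializationAt_snd_eq_tangentCoord hx, tangentCoord_tangentOfCoord hx]

end Auxiliary

/-! ### Linearity of lifting through the lifted Euler field. -/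

section Connection

variable {VM : Type*} [NormedAddCommGroup VM] [NormedSpace ℝ VM]
  {VE : Type*} [NormedAddCommGroup VE] [NormedSpace ℝ VE]
  {M : Type*} [TopologicalSpace M] [ChartedSpace VM M]
  {E : Type*} [TopologicalSpace E] [ChartedSpace VE E]
  {π : E → M} {Λ : (ℝ → M) → Set ℝ → (ℝ → E) → Prop}

theorem velocity_eq_of_proj {γ : ℝ → M} {c : ℝ → E} {J : Set ℝ}
    (hc : ContMDiffOn 𝓘(ℝ, ℝ) 𝓘(ℝ, VE) 1 c J) (hp : ∀ t ∈ J, π (c t) = γ t)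
    (hπ : MDifferentiable 𝓘(ℝ, VE) 𝓘(ℝ, VM) π) (hu : UniqueDiffOn ℝ J) {t : ℝ} (ht : t ∈ J) :
    velocity VM γ J t = tangentMap 𝓘(ℝ, VE) 𝓘(ℝ, VM) π (velocity VE c J t) := by
  rw [tangentMap_velocity ht hu (hπ _) (hc.mdiffWithinAt ht)]
  exact velocity_congr (fun t ht ↦ (hp t ht).symm) ht

theorem RuleVelocity.mfderiv_eq (hΛ : IsLiftRule VM VE π Λ)
    (hπ : MDifferentiable 𝓘(ℝ, VE) 𝓘(ℝ, VM) π) {p : E}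
    {v : TangentSpace 𝓘(ℝ, VM) (π p)} {w : TangentSpace 𝓘(ℝ, VE) p}
    (h : RuleVelocity VM VE π Λ p v w) : mfderiv 𝓘(ℝ, VE) 𝓘(ℝ, VM) π p w = v := by
  obtain ⟨γ, J, c, s, hγ, hc, hs, hcs, hJ, hv, hw⟩ := h
  have h1 := velocity_eq_of_proj (hΛ.contMDiffOn hγ hc) (hΛ.proj hc) hπ
    (hγ.ordConnected.uniqueDiffOn_real hJ) hs
  rw [hv, hw] at h1
  exact (Bundle.TotalSpace.mk_inj.1 h1).symm

variable [IsManifold 𝓘(ℝ, VM) 1 M] [IsManifold 𝓘(ℝ, VE) 1 E] {k : ℕ∞}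

/-- Scaling by `2` leaves the zero vector below unchanged, so uniqueness gives `w = 2 w`. -/
theorem RuleVelocity.eq_zero (hΛ : IsRegularLiftRule VM VE k π Λ) {p : E}
    {w : TangentSpace 𝓘(ℝ, VE) p} (h : RuleVelocity VM VE π Λ p 0 w) : w = 0 := by
  have h1 := h.smul hΛ.toIsLiftRule (a := 2) (by norm_num)
  rw [smul_zero] at h1
  have h2 := hΛ.velocity_unique p _ _ _ h h1
  rw [two_smul] at h2
  exact left_eq_add.1 h2

theorem IsRegularLiftRule.exists_ruleVelocity (hΛ : IsRegularLiftRule VM VE k π Λ) (p : E)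
    (v : TangentSpace 𝓘(ℝ, VM) (π p)) : ∃ w, RuleVelocity VM VE π Λ p v w := by
  obtain ⟨γ, ε, c, w, hε, hγ, hc, hc0, hv, hw, -⟩ := hΛ.exists_velocity p v
  exact ⟨w, γ, _, c, 0, hγ, hc, ⟨by linarith, hε.le⟩, hc0,
    ⟨_, left_mem_Icc.2 (by linarith), _, right_mem_Icc.2 (by linarith), by linarith⟩, hv, hw⟩

/-- The lift of a vector `v` to a point `p`. -/
noncomputable def IsRegularLiftRule.liftVec (hΛ : IsRegularLiftRule VM VE k π Λ) (p : E)
    (v : TangentSpace 𝓘(ℝ, VM) (π p)) : TangentSpace 𝓘(ℝ, VE) p :=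
  (hΛ.exists_ruleVelocity p v).choose

namespace IsRegularLiftRule

variable (hΛ : IsRegularLiftRule VM VE k π Λ)

theorem ruleVelocity_liftVec (p : E) (v : TangentSpace 𝓘(ℝ, VM) (π p)) :
    RuleVelocity VM VE π Λ p v (hΛ.liftVec p v) :=
  (hΛ.exists_ruleVelocity p v).choose_spec

theorem liftVec_eq {p : E} {v : TangentSpace 𝓘(ℝ, VM) (π p)} {w : TangentSpace 𝓘(ℝ, VE) p}
    (h : RuleVelocity VM VE π Λ p v w) : hΛ.liftVec p v = w :=
  hΛ.velocity_unique p v _ _ (hΛ.ruleVelocity_liftVec p v) h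

theorem liftVec_zero (p : E) : hΛ.liftVec p 0 = 0 :=
  (hΛ.ruleVelocity_liftVec p 0).eq_zero hΛ

theorem liftVec_smul (p : E) (a : ℝ) (v : TangentSpace 𝓘(ℝ, VM) (π p)) :
    hΛ.liftVec p (a • v) = a • hΛ.liftVec p v := by
  rcases eq_or_ne a 0 with rfl | ha
  · rw [zero_smul, zero_smul, hΛ.liftVec_zero]
  · exact hΛ.liftVec_eq ((hΛ.ruleVelocity_liftVec p v).smul hΛ.toIsLiftRule ha)

variable [IsManifold 𝓘(ℝ, VM) (k + 1) M]

/-- The lift of a vector field which is `C^k` in the coordinates of a chart. -/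
theorem isVectorFieldOn_liftVec (x₀ : M) {f : M → VM}
    (hf : ContMDiffOn 𝓘(ℝ, VM) 𝓘(ℝ, VM) k f (chartAt VM x₀).source) :
    IsVectorFieldOn VE k (fun p ↦ hΛ.liftVec p (tangentOfCoord x₀ (π p) (f (π p))))
      (π ⁻¹' (chartAt VM x₀).source) :=
  hΛ.smooth _ _ _ (chartAt VM x₀).open_source (isVectorFieldOn_tangentOfCoord x₀ hf)
    fun p _ ↦ hΛ.ruleVelocity_liftVec p _

theorem contMDiffAt_coord_liftVec (hπ : Continuous π) (p : E) {f : M → VM}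
    (hf : ContMDiffOn 𝓘(ℝ, VM) 𝓘(ℝ, VM) k f (chartAt VM (π p)).source) :
    ContMDiffAt 𝓘(ℝ, VE) 𝓘(ℝ, VE) k
      (fun q ↦ tangentCoord p ⟨q, hΛ.liftVec q (tangentOfCoord (π p) (π q) (f (π q)))⟩) p :=
  contMDiffAt_vectorField_iff.1 ((hΛ.isVectorFieldOn_liftVec (π p) hf).contMDiffAt
    (((chartAt VM (π p)).open_source.preimage hπ).mem_nhds (mem_chart_source VM (π p))))

/-- The coordinates of the lift of the Euler vector field of the chart at `π p`. -/
noncomputable def eulerLift (p q : E) : VE :=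
  tangentCoord p ⟨q, hΛ.liftVec q (tangentOfCoord (π p) (π q)
    (extChartAt 𝓘(ℝ, VM) (π p) (π q) - extChartAt 𝓘(ℝ, VM) (π p) (π p)))⟩

theorem contMDiffAt_eulerLift (hπ : Continuous π) (p : E) :
    ContMDiffAt 𝓘(ℝ, VE) 𝓘(ℝ, VE) k (hΛ.eulerLift p) p := by
  refine hΛ.contMDiffAt_coord_liftVec hπ p (f := fun x ↦
    extChartAt 𝓘(ℝ, VM) (π p) x - extChartAt 𝓘(ℝ, VM) (π p) (π p)) ?_
  have : IsManifold 𝓘(ℝ, VM) k M := IsManifold.of_le (n := k + 1) le_self_add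
  exact contMDiffOn_extChartAt.sub contMDiffOn_const

/-- The Euler field vanishes there, and zero lifts to zero. Equality of chart values is the form in
which the implicit function theorem describes the fibre. -/
theorem eulerLift_eq_zero {p q : E}
    (h : extChartAt 𝓘(ℝ, VM) (π p) (π q) = extChartAt 𝓘(ℝ, VM) (π p) (π p)) :
    hΛ.eulerLift p q = 0 := by
  rw [eulerLift, h, sub_self, tangentOfCoord_zero, hΛ.liftVec_zero, tangentCoord_zero]

/-- Along the lift `c` of the chart line with velocity `v` the Euler field below is `s v`. By
homogeneity its lift is `s • g (c s)`, where `g` is the lift of the constant field `v`, and the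
derivative at `0` is `g p`, the lift of `v`. -/
theorem mfderiv_eulerLift_liftVec (hk : 1 ≤ k) (hπ : Continuous π) (p : E) (v : VM) :
    (mfderiv 𝓘(ℝ, VE) 𝓘(ℝ, VE) (hΛ.eulerLift p) p (hΛ.liftVec p v) : VE) = hΛ.liftVec p v := by
  obtain ⟨γ, ε, c, w, hε, hγ, hc, hc0, hv, hw, hlin⟩ := hΛ.exists_velocity p v
  have h0 : (0 : ℝ) ∈ Icc (-ε) ε := ⟨by linarith, hε.le⟩
  have hu := uniqueDiffOn_Icc (show -ε < ε by linarith)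
  have hk0 : (k : WithTop ℕ∞) ≠ 0 := by
    have : k ≠ 0 := (zero_lt_one.trans_le hk).ne'
    exact_mod_cast this
  have hcC := hΛ.contMDiffOn hγ hc
  have hwv : hΛ.liftVec p v = w := hΛ.liftVec_eq ⟨γ, _, c, 0, hγ, hc, h0, hc0,
    ⟨_, left_mem_Icc.2 (by linarith), _, right_mem_Icc.2 (by linarith), by linarith⟩, hv, hw⟩
  have h1 := hasDerivWithinAt_comp_velocity
    ((hΛ.contMDiffAt_eulerLift hπ p).mdifferentiableAt hk0) (hcC.mdiffWithinAt h0) hw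
  let g : E → VE := fun q ↦ tangentCoord p ⟨q, hΛ.liftVec q (tangentOfCoord (π p) (π q) v)⟩
  have hg : ContinuousAt g p := (hΛ.contMDiffAt_coord_liftVec hπ p
    (f := fun _ ↦ v) contMDiffOn_const).continuousAt
  have hgc : ContinuousWithinAt (g ∘ c) (Icc (-ε) ε) 0 :=
    ContinuousAt.comp_continuousWithinAt (by rwa [hc0]) (hcC.continuousOn 0 h0)
  have h2 := hasDerivWithinAt_id_smul hgc
  have h3 : HasDerivWithinAt (hΛ.eulerLift p ∘ c) ((g ∘ c) 0) (Icc (-ε) ε) 0 := by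
    refine h2.congr_of_mem (fun s hs ↦ ?_) h0
    have e := (hlin s hs).2
    rw [← hΛ.proj hc s hs] at e
    simp only [Function.comp, eulerLift, g]
    rw [e, add_sub_cancel_left, tangentOfCoord_smul, hΛ.liftVec_smul, tangentCoord_smul]
  have h4 := (hu 0 h0).eq_deriv _ h1 h3
  rw [hwv]
  refine h4.trans ?_
  simp only [Function.comp, g, hc0]
  rw [tangentCoord_self, tangentOfCoord_self]
  exact hwv

/-- Since `π` is a submersion, a vertical vector is tangent to a curve inside the fibre, and on the
fibre the lifted Euler field vanishes. -/
theorem mfderiv_eulerLift_of_vertical [FiniteDimensional ℝ VM] [FiniteDimensional ℝ VE]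
    (hk : 1 ≤ k) (hπ : ContMDiff 𝓘(ℝ, VE) 𝓘(ℝ, VM) 1 π) (p : E)
    (hsub : Function.Surjective (mfderiv 𝓘(ℝ, VE) 𝓘(ℝ, VM) π p)) {z : TangentSpace 𝓘(ℝ, VE) p}
    (hz : mfderiv 𝓘(ℝ, VE) 𝓘(ℝ, VM) π p z = 0) :
    (mfderiv 𝓘(ℝ, VE) 𝓘(ℝ, VE) (hΛ.eulerLift p) p z : VE) = 0 := by
  have hk0 : (k : WithTop ℕ∞) ≠ 0 := by
    have : k ≠ 0 := (zero_lt_one.trans_le hk).ne'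
    exact_mod_cast this
  let φ := extChartAt 𝓘(ℝ, VE) p
  let f : VE → VM := extChartAt 𝓘(ℝ, VM) (π p) ∘ π ∘ φ.symm
  let f' : VE →L[ℝ] VM := mfderiv 𝓘(ℝ, VE) 𝓘(ℝ, VM) π p
  have hφ : ContinuousAt φ.symm (φ p) := continuousAt_extChartAt_symm p
  have hφp : φ.symm (φ p) = p := extChartAt_to_inv p
  have hf : ContDiffAt ℝ 1 f (φ p) := by
    have := (contMDiffAt_iff.1 (hπ p)).2
    rw [← contDiffWithinAt_univ]
    simpa [f, φ] using this
  have hf' : HasFDerivAt f f' (φ p) := by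
    have : HasFDerivWithinAt (writtenInExtChartAt 𝓘(ℝ, VE) 𝓘(ℝ, VM) p π) f'
        (range 𝓘(ℝ, VE)) (φ p) := ((hπ p).mdifferentiableAt one_ne_zero).hasMFDerivAt.2
    rw [← hasFDerivWithinAt_univ]
    simpa [f, φ] using this
  have hstrict : HasStrictFDerivAt f f' (φ p) := hf.hasStrictFDerivAt' hf' one_ne_zero
  have hrange : f'.range = ⊤ := LinearMap.range_eq_top.2 hsub
  let G : VE → VE := hΛ.eulerLift p ∘ φ.symm
  let L : VE →L[ℝ] VE := mfderiv 𝓘(ℝ, VE) 𝓘(ℝ, VE) (hΛ.eulerLift p) p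
  have hG : HasFDerivAt G L (φ p) := by
    have : HasFDerivWithinAt (writtenInExtChartAt 𝓘(ℝ, VE) 𝓘(ℝ, VE) p (hΛ.eulerLift p)) L
        (range 𝓘(ℝ, VE)) (φ p) :=
      ((hΛ.contMDiffAt_eulerLift hπ.continuous p).mdifferentiableAt hk0).hasMFDerivAt.2
    rw [← hasFDerivWithinAt_univ]
    simpa [G, φ, chartAt_self_eq] using this
  let zk : f'.ker := ⟨z, hz⟩
  -- The implicit function parametrizes the level set of `f` through `φ p` by the kernel of `f'`,
  -- with the inclusion as derivative at `0`; hence `g` has velocity `z` at `0`.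
  let g : ℝ → VE := fun s ↦ hstrict.implicitFunction f f' hrange (f (φ p)) (s • zk)
  have hg0 : g 0 = φ p := by
    simp only [g, zero_smul]
    exact hstrict.implicitFunction_apply_image hrange
  have hl : HasDerivAt (fun s : ℝ ↦ s • zk) zk 0 := by
    simpa using (hasDerivAt_id (0 : ℝ)).smul_const zk
  have hg : HasDerivAt g z 0 := by
    have h1 := (hstrict.to_implicitFunction hrange).hasFDerivAt
    rw [← zero_smul ℝ zk] at h1
    exact h1.comp_hasDerivAt (0 : ℝ) hl
  have hGg : HasDerivAt (G ∘ g) (L z) 0 := by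
    rw [← hg0] at hG
    exact hG.comp_hasDerivAt (0 : ℝ) hg
  have hfg : ∀ᶠ s in 𝓝 (0 : ℝ), f (g s) = f (φ p) := by
    have h1 := hstrict.map_implicitFunction_eq hrange
    have h2 : Tendsto (fun s : ℝ ↦ (f (φ p), s • zk)) (𝓝 0) (𝓝 (f (φ p), 0)) := by
      refine tendsto_const_nhds.prodMk_nhds ?_
      have := hl.continuousAt.tendsto
      rwa [zero_smul] at this
    exact h2.eventually h1
  have hzero : G ∘ g =ᶠ[𝓝 0] fun _ ↦ 0 := by
    filter_upwards [hfg] with s hs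
    refine hΛ.eulerLift_eq_zero ?_
    simp only [f, Function.comp, hφp] at hs
    exact hs
  exact hGg.unique ((hasDerivAt_const (0 : ℝ) (0 : VE)).congr_of_eventuallyEq hzero)

end IsRegularLiftRule

end Connection

/-! ### The connection defined by a regular lift rule. -/

section Connection

variable {VM : Type*} [NormedAddCommGroup VM] [NormedSpace ℝ VM] [FiniteDimensional ℝ VM]
  {VE : Type*} [NormedAddCommGroup VE] [NormedSpace ℝ VE] [FiniteDimensional ℝ VE]
  {M : Type*} [TopologicalSpace M] [ChartedSpace VM M]
  {E : Type*} [TopologicalSpace E] [ChartedSpace VE E]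
  {π : E → M} {Λ : (ℝ → M) → Set ℝ → (ℝ → E) → Prop}
  [IsManifold 𝓘(ℝ, VM) 1 M] [IsManifold 𝓘(ℝ, VE) 1 E] {k : ℕ∞}
  [IsManifold 𝓘(ℝ, VM) (k + 1) M]

namespace IsRegularLiftRule

/-- The velocities of the lifts through `p`, as a linear subspace: the fixed vectors of the
derivative at `p` of the lift of the Euler vector field. -/
noncomputable def horizontal (hΛ : IsRegularLiftRule VM VE k π Λ) (p : E) :
    Submodule ℝ (TangentSpace 𝓘(ℝ, VE) p) :=
  LinearMap.eqLocus
    (mfderiv 𝓘(ℝ, VE) 𝓘(ℝ, VE) (hΛ.eulerLift p) p : VE →L[ℝ] VE).toLinearMap LinearMap.id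

variable (hΛ : IsRegularLiftRule VM VE k π Λ)

theorem mem_horizontal_iff {p : E} {w : TangentSpace 𝓘(ℝ, VE) p} :
    w ∈ hΛ.horizontal p ↔
      (mfderiv 𝓘(ℝ, VE) 𝓘(ℝ, VE) (hΛ.eulerLift p) p w : VE) = w :=
  Iff.rfl

variable (hk : 1 ≤ k) (hπ : ContMDiff 𝓘(ℝ, VE) 𝓘(ℝ, VM) 1 π)
  (hsub : ∀ p : E, Function.Surjective (mfderiv 𝓘(ℝ, VE) 𝓘(ℝ, VM) π p))

include hk hπ

theorem liftVec_mem_horizontal (p : E) (v : TangentSpace 𝓘(ℝ, VM) (π p)) :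
    hΛ.liftVec p v ∈ hΛ.horizontal p :=
  hΛ.mem_horizontal_iff.2 (hΛ.mfderiv_eulerLift_liftVec hk hπ.continuous p v)

theorem mfderiv_liftVec (p : E) (v : TangentSpace 𝓘(ℝ, VM) (π p)) :
    mfderiv 𝓘(ℝ, VE) 𝓘(ℝ, VM) π p (hΛ.liftVec p v) = v :=
  (hΛ.ruleVelocity_liftVec p v).mfderiv_eq hΛ.toIsLiftRule (hπ.mdifferentiable one_ne_zero)

include hsub

theorem eq_zero_of_mem_horizontal {p : E} {w : TangentSpace 𝓘(ℝ, VE) p}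
    (hw : w ∈ hΛ.horizontal p) (hv : mfderiv 𝓘(ℝ, VE) 𝓘(ℝ, VM) π p w = 0) : w = 0 :=
  (hΛ.mem_horizontal_iff.1 hw).symm.trans
    (hΛ.mfderiv_eulerLift_of_vertical hk hπ p (hsub p) hv)

theorem eq_of_mem_horizontal {p : E} {w w' : TangentSpace 𝓘(ℝ, VE) p}
    (hw : w ∈ hΛ.horizontal p) (hw' : w' ∈ hΛ.horizontal p)
    (hv : mfderiv 𝓘(ℝ, VE) 𝓘(ℝ, VM) π p w = mfderiv 𝓘(ℝ, VE) 𝓘(ℝ, VM) π p w') : w = w' := by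
  refine sub_eq_zero.1 (hΛ.eq_zero_of_mem_horizontal hk hπ hsub (sub_mem hw hw') ?_)
  rw [map_sub, hv, sub_self]

/-- A fixed vector and the lift of its projection differ by a vector that is both fixed and
vertical, hence by zero. -/
theorem mem_horizontal_iff_ruleVelocity {p : E} {w : TangentSpace 𝓘(ℝ, VE) p} :
    w ∈ hΛ.horizontal p ↔ ∃ v, RuleVelocity VM VE π Λ p v w := by
  constructor
  · intro hw
    refine ⟨mfderiv 𝓘(ℝ, VE) 𝓘(ℝ, VM) π p w, ?_⟩
    have h := hΛ.ruleVelocity_liftVec p (mfderiv 𝓘(ℝ, VE) 𝓘(ℝ, VM) π p w)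
    rwa [hΛ.eq_of_mem_horizontal hk hπ hsub (hΛ.liftVec_mem_horizontal hk hπ p _) hw
      (hΛ.mfderiv_liftVec hk hπ p _)] at h
  · rintro ⟨v, hv⟩
    rw [← hΛ.liftVec_eq hv]
    exact hΛ.liftVec_mem_horizontal hk hπ p v

theorem isConnection_horizontal : IsConnection VM VE k π hΛ.horizontal where
  isCompl p := by
    refine ⟨?_, ?_⟩
    · rw [Submodule.disjoint_def]
      exact fun w hw hv ↦ hΛ.eq_zero_of_mem_horizontal hk hπ hsub hw hv
    · rw [codisjoint_iff, eq_top_iff]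
      rintro w -
      rw [Submodule.mem_sup]
      refine ⟨hΛ.liftVec p (mfderiv 𝓘(ℝ, VE) 𝓘(ℝ, VM) π p w), hΛ.liftVec_mem_horizontal hk hπ p _,
        w - hΛ.liftVec p (mfderiv 𝓘(ℝ, VE) 𝓘(ℝ, VM) π p w), ?_, add_sub_cancel _ _⟩
      change mfderiv 𝓘(ℝ, VE) 𝓘(ℝ, VM) π p (_ - _) = 0
      rw [map_sub, hΛ.mfderiv_liftVec hk hπ, sub_self]
  smooth p₀ := by
    let b := Module.finBasis ℝ VM
    let Z : Fin (Module.finrank ℝ VM) → ∀ p : E, TangentSpace 𝓘(ℝ, VE) p :=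
      fun i p ↦ hΛ.liftVec p (tangentOfCoord (π p₀) (π p) (b i))
    refine ⟨π ⁻¹' (chartAt VM (π p₀)).source, (chartAt VM (π p₀)).open_source.preimage
      hπ.continuous, mem_chart_source VM (π p₀), Z, fun i ↦ ?_, fun p hp ↦ le_antisymm ?_ ?_⟩
    · exact hΛ.isVectorFieldOn_liftVec (π p₀) (f := fun _ ↦ b i) contMDiffOn_const
    · intro w hw
      -- The coefficients of the projection of `w`. The combination of the lifted frame with these
      -- coefficients is horizontal and has the same projection as `w`, so it equals `w`.
      let a := b.repr (tangentCoord (π p₀) ⟨π p, mfderiv 𝓘(ℝ, VE) 𝓘(ℝ, VM) π p w⟩)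
      have hZ : ∑ i, a i • Z i p ∈ Submodule.span ℝ (range fun i ↦ Z i p) :=
        sum_mem fun i _ ↦ Submodule.smul_mem _ _ (Submodule.subset_span ⟨i, rfl⟩)
      have hZ' : ∑ i, a i • Z i p ∈ hΛ.horizontal p :=
        sum_mem fun i _ ↦ Submodule.smul_mem _ _ (hΛ.liftVec_mem_horizontal hk hπ p _)
      have hproj : mfderiv 𝓘(ℝ, VE) 𝓘(ℝ, VM) π p w =
          mfderiv 𝓘(ℝ, VE) 𝓘(ℝ, VM) π p (∑ i, a i • Z i p) := by
        rw [map_sum]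
        simp only [map_smul, Z, hΛ.mfderiv_liftVec hk hπ]
        have h1 : tangentOfCoord (π p₀) (π p) (∑ i, a i • b i) =
            ∑ i, a i • tangentOfCoord (π p₀) (π p) (b i) := by
          simp only [← tangentOfCoord_smul]
          exact map_sum (mfderiv 𝓘(ℝ, VM) 𝓘(ℝ, VM) (extChartAt 𝓘(ℝ, VM) (π p₀)) (π p)).inverse
            (fun i ↦ a i • b i) Finset.univ
        rw [← h1, b.sum_repr, tangentOfCoord_tangentCoord hp]
      rwa [hΛ.eq_of_mem_horizontal hk hπ hsub hw hZ' hproj]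
    · rw [Submodule.span_le]
      rintro _ ⟨i, rfl⟩
      exact hΛ.liftVec_mem_horizontal hk hπ p _

theorem isHorizontalLift {γ : ℝ → M} {J : Set ℝ} {c : ℝ → E} (h : IsPath VM γ J) (hc : Λ γ J c) :
    IsHorizontalLift VE π hΛ.horizontal γ J c where
  contMDiffOn := hΛ.contMDiffOn h hc
  proj := hΛ.proj hc
  horizontal t ht := by
    rcases J.subsingleton_or_nontrivial with hJ | hJ
    · rw [velocity_snd_eq_zero hJ]
      exact zero_mem _
    · exact (hΛ.mem_horizontal_iff_ruleVelocity hk hπ hsub).2 ⟨_, γ, J, c, t, h, hc, ht, rfl, hJ,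
        velocity_eq_of_proj (hΛ.contMDiffOn h hc) (hΛ.proj hc) (hπ.mdifferentiable one_ne_zero)
          (h.ordConnected.uniqueDiffOn_real hJ) ht, rfl⟩

end IsRegularLiftRule

end Connection

/-! ### Horizontal vectors and horizontal lifts. -/

section HorizontalLift

variable {VM : Type*} [NormedAddCommGroup VM] [NormedSpace ℝ VM]
  {VE : Type*} [NormedAddCommGroup VE] [NormedSpace ℝ VE]
  {M : Type*} [TopologicalSpace M] [ChartedSpace VM M]
  {E : Type*} [TopologicalSpace E] [ChartedSpace VE E]
  {π : E → M} [IsManifold 𝓘(ℝ, VM) 1 M] [IsManifold 𝓘(ℝ, VE) 1 E] {k : ℕ∞}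
  {H : ∀ p : E, Submodule ℝ (TangentSpace 𝓘(ℝ, VE) p)}

theorem velocity_mem {c : ℝ → E} {J : Set ℝ} {t : ℝ} {p : E} {w : TangentSpace 𝓘(ℝ, VE) p}
    (h : velocity VE c J t = ⟨p, w⟩) (hw : w ∈ H p) : (velocity VE c J t).2 ∈ H (c t) := by
  have h1 : (velocity VE c J t).2 ∈ H (velocity VE c J t).1 := by rw [h]; exact hw
  exact h1

theorem RuleVelocity.mem {p : E} {v : TangentSpace 𝓘(ℝ, VM) (π p)} {w : TangentSpace 𝓘(ℝ, VE) p}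
    (h : RuleVelocity VM VE π (IsHorizontalLift VE π H) p v w) : w ∈ H p := by
  obtain ⟨γ, J, c, s, hγ, hc, hs, hcs, hJ, hv, hw⟩ := h
  have h1 : (velocity VE c J s).2 ∈ H (velocity VE c J s).1 := hc.horizontal s hs
  rwa [hw] at h1

theorem IsConnection.eq_of_mfderiv_eq (hH : IsConnection VM VE k π H) {p : E}
    {w w' : TangentSpace 𝓘(ℝ, VE) p} (hw : w ∈ H p) (hw' : w' ∈ H p)
    (h : mfderiv 𝓘(ℝ, VE) 𝓘(ℝ, VM) π p w = mfderiv 𝓘(ℝ, VE) 𝓘(ℝ, VM) π p w') : w = w' := by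
  refine sub_eq_zero.1 (Submodule.disjoint_def.1 (hH.isCompl p).disjoint _ (sub_mem hw hw') ?_)
  change mfderiv 𝓘(ℝ, VE) 𝓘(ℝ, VM) π p (w - w') = 0
  rw [map_sub, h, sub_self]

theorem IsConnection.exists_mfderiv_eq (hH : IsConnection VM VE k π H) {p : E}
    (hsub : Function.Surjective (mfderiv 𝓘(ℝ, VE) 𝓘(ℝ, VM) π p))
    (v : TangentSpace 𝓘(ℝ, VM) (π p)) :
    ∃ w ∈ H p, mfderiv 𝓘(ℝ, VE) 𝓘(ℝ, VM) π p w = v := by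
  obtain ⟨w, hw⟩ := hsub v
  have h : w ∈ H p ⊔ (mfderiv 𝓘(ℝ, VE) 𝓘(ℝ, VM) π p).ker := by
    rw [(hH.isCompl p).sup_eq_top]; trivial
  obtain ⟨y, hy, z, hz, rfl⟩ := Submodule.mem_sup.1 h
  refine ⟨y, hy, ?_⟩
  rw [map_add] at hw
  have hz' : mfderiv 𝓘(ℝ, VE) 𝓘(ℝ, VM) π p z = 0 := hz
  rwa [hz', add_zero] at hw

namespace IsHorizontalLift

variable {γ : ℝ → M} {J J' : Set ℝ} {c : ℝ → E}

theorem congr (hc : IsHorizontalLift VE π H γ J c) {γ' : ℝ → M} (e : EqOn γ γ' J) :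
    IsHorizontalLift VE π H γ' J c :=
  ⟨hc.contMDiffOn, fun t ht ↦ (hc.proj t ht).trans (e ht), hc.horizontal⟩

theorem mono (hc : IsHorizontalLift VE π H γ J c) (hJ : J' ⊆ J) (hoc : J'.OrdConnected) :
    IsHorizontalLift VE π H γ J' c where
  contMDiffOn := hc.contMDiffOn.mono hJ
  proj t ht := hc.proj t (hJ ht)
  horizontal t ht := by
    rcases J'.subsingleton_or_nontrivial with h | h
    · rw [velocity_snd_eq_zero h]
      exact zero_mem _
    · rw [velocity_mono hJ ht (hoc.uniqueDiffOn_real h) (hc.contMDiffOn.mdiffWithinAt (hJ ht))]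
      exact hc.horizontal t (hJ ht)

theorem reparam (hc : IsHorizontalLift VE π H γ J c) {χ : ℝ → ℝ} (hoc : J'.OrdConnected)
    (hm : MapsTo χ J' J) (hd : ContDiffOn ℝ 1 χ J') :
    IsHorizontalLift VE π H (γ ∘ χ) J' (c ∘ χ) where
  contMDiffOn := hc.contMDiffOn.comp hd.contMDiffOn hm
  proj t ht := hc.proj (χ t) (hm ht)
  horizontal t ht := by
    rcases J'.subsingleton_or_nontrivial with h | h
    · rw [velocity_snd_eq_zero h]
      exact zero_mem _
    · exact velocity_mem (velocity_comp ht (hoc.uniqueDiffOn_real h) hm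
        (hd.differentiableOn one_ne_zero t ht) (hc.contMDiffOn.mdiffWithinAt (hm ht)))
        (Submodule.smul_mem _ _ (hc.horizontal (χ t) (hm ht)))

end IsHorizontalLift

end HorizontalLift

/-! ### A connection in coordinates. -/

section Coordinates

variable {VM : Type*} [NormedAddCommGroup VM] [NormedSpace ℝ VM] [FiniteDimensional ℝ VM]
  {VE : Type*} [NormedAddCommGroup VE] [NormedSpace ℝ VE] [FiniteDimensional ℝ VE]
  {M : Type*} [TopologicalSpace M] [ChartedSpace VM M]
  {E : Type*} [TopologicalSpace E] [ChartedSpace VE E]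
  {π : E → M} [IsManifold 𝓘(ℝ, VM) 1 M] [IsManifold 𝓘(ℝ, VE) 1 E] {k : ℕ∞}
  {H : ∀ p : E, Submodule ℝ (TangentSpace 𝓘(ℝ, VE) p)}

theorem ContMDiffAt.tangentCoord {n : WithTop ℕ∞} {f : E → TangentBundle 𝓘(ℝ, VM) M} {p : E}
    (hf : ContMDiffAt 𝓘(ℝ, VE) 𝓘(ℝ, VM).tangent n f p) :
    ContMDiffAt 𝓘(ℝ, VE) 𝓘(ℝ, VM) n (fun q ↦ _root_.tangentCoord (f p).1 (f q)) p := by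
  obtain ⟨h1, h2⟩ := (Bundle.contMDiffAt_totalSpace (IB := 𝓘(ℝ, VM))).1 hf
  refine h2.congr_of_eventuallyEq ?_
  filter_upwards [h1.continuousAt.eventually ((chartAt VM (f p).1).open_source.mem_nhds
    (mem_chart_source VM (f p).1))] with q hq
  exact (trivializationAt_snd_eq_tangentCoord hq (f q).2).symm

/-- In coordinates, the horizontal vectors of a `C^k` connection depend in a `C^k` fashion on the
point and linearly on their projections. -/
theorem IsConnection.exists_coord (hH : IsConnection VM VE k π H)
    (hπ : ContMDiff 𝓘(ℝ, VE) 𝓘(ℝ, VM) (k + 1) π)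
    (hsub : ∀ p : E, Function.Surjective (mfderiv 𝓘(ℝ, VE) 𝓘(ℝ, VM) π p)) (p₀ : E) :
    ∃ A : E → VM →L[ℝ] VE, ContMDiffAt 𝓘(ℝ, VE) 𝓘(ℝ, VM →L[ℝ] VE) k A p₀ ∧
      ∀ᶠ q in 𝓝 p₀, ∀ w ∈ H q, tangentCoord p₀ ⟨q, w⟩ =
        A q (tangentCoord (π p₀) ⟨π q, mfderiv 𝓘(ℝ, VE) 𝓘(ℝ, VM) π q w⟩) := by
  obtain ⟨U, hU, hpU, Z, hZ, hspan⟩ := hH.smooth p₀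
  let b := Module.finBasis ℝ VM
  let β : Fin (Module.finrank ℝ VM) → (VM →L[ℝ] ℝ) := fun i ↦ (b.coord i).toContinuousLinearMap
  let ζ : Fin (Module.finrank ℝ VM) → E → VE := fun i q ↦ tangentCoord p₀ ⟨q, Z i q⟩
  let η : Fin (Module.finrank ℝ VM) → E → VM := fun i q ↦
    tangentCoord (π p₀) ⟨π q, mfderiv 𝓘(ℝ, VE) 𝓘(ℝ, VM) π q (Z i q)⟩
  have hZ' : ∀ i, ContMDiffAt 𝓘(ℝ, VE) 𝓘(ℝ, VE).tangent k
      (fun q ↦ (⟨q, Z i q⟩ : TangentBundle 𝓘(ℝ, VE) E)) p₀ := fun i ↦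
    (hZ i).contMDiffAt (hU.mem_nhds hpU)
  have hζ : ∀ i, ContMDiffAt 𝓘(ℝ, VE) 𝓘(ℝ, VE) k (ζ i) p₀ := fun i ↦
    contMDiffAt_vectorField_iff.1 (hZ' i)
  have hη : ∀ i, ContMDiffAt 𝓘(ℝ, VE) 𝓘(ℝ, VM) k (η i) p₀ := fun i ↦
    (((hπ.contMDiff_tangentMap le_rfl).contMDiffAt).comp p₀ (hZ' i)).tangentCoord
  -- For a local frame `Z` of `H`, the map `C q` sends coefficients to the horizontal vector and `B
  -- q` to its projection, both in coordinates. Hence `A` is `C` after the inverse of `B`.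
  let B : E → VM →L[ℝ] VM := fun q ↦ ∑ i, ContinuousLinearMap.smulRightL ℝ VM VM (β i) (η i q)
  let C : E → VM →L[ℝ] VE := fun q ↦ ∑ i, ContinuousLinearMap.smulRightL ℝ VM VE (β i) (ζ i q)
  have hB : ContMDiffAt 𝓘(ℝ, VE) 𝓘(ℝ, VM →L[ℝ] VM) k B p₀ :=
    contMDiffAt_finsetSum fun i _ ↦
      (ContinuousLinearMap.smulRightL ℝ VM VM (β i)).contDiff.contDiffAt.comp_contMDiffAt (hη i)
  have hC : ContMDiffAt 𝓘(ℝ, VE) 𝓘(ℝ, VM →L[ℝ] VE) k C p₀ :=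
    contMDiffAt_finsetSum fun i _ ↦
      (ContinuousLinearMap.smulRightL ℝ VM VE (β i)).contDiff.contDiffAt.comp_contMDiffAt (hζ i)
  have hBapp : ∀ q u, B q u = ∑ i, b.repr u i • η i q := fun q u ↦ by
    simp [B, β]
  have hCapp : ∀ q u, C q u = ∑ i, b.repr u i • ζ i q := fun q u ↦ by
    simp [C, β]
  have key : ∀ q ∈ U, ∀ w ∈ H q, ∃ u : VM,
      B q u = tangentCoord (π p₀) ⟨π q, mfderiv 𝓘(ℝ, VE) 𝓘(ℝ, VM) π q w⟩ ∧
      C q u = tangentCoord p₀ ⟨q, w⟩ := by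
    intro q hq w hw
    rw [hspan q hq] at hw
    obtain ⟨a, rfl⟩ := (Submodule.mem_span_range_iff_exists_fun ℝ).1 hw
    refine ⟨∑ i, a i • b i, ?_, ?_⟩
    · rw [hBapp, b.repr_sum_self]
      have h1 : mfderiv 𝓘(ℝ, VE) 𝓘(ℝ, VM) π q (∑ i, a i • Z i q) =
          ∑ i, a i • mfderiv 𝓘(ℝ, VE) 𝓘(ℝ, VM) π q (Z i q) := by
        rw [map_sum]; simp only [map_smul]
      rw [h1]
      simp only [η, ← tangentCoord_smul]
      exact (map_sum (mfderiv 𝓘(ℝ, VM) 𝓘(ℝ, VM) (extChartAt 𝓘(ℝ, VM) (π p₀)) (π q)) _ _).symm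
    · rw [hCapp, b.repr_sum_self]
      simp only [ζ, ← tangentCoord_smul]
      exact (map_sum (mfderiv 𝓘(ℝ, VE) 𝓘(ℝ, VE) (extChartAt 𝓘(ℝ, VE) p₀) q) _ _).symm
  have hinv : ∀ q ∈ U, π q ∈ (chartAt VM (π p₀)).source → (B q).IsInvertible := by
    intro q hq hs
    -- `dπ` maps `H q` onto the tangent space below. As `B q` is an endomorphism of a
    -- finite-dimensional space, surjectivity is enough.
    have hsurj : Function.Surjective (B q) := fun y ↦ by
      obtain ⟨w, hw, hwv⟩ := hH.exists_mfderiv_eq (hsub q) (tangentOfCoord (π p₀) (π q) y)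
      obtain ⟨u, hu, -⟩ := key q hq w hw
      exact ⟨u, by rw [hu, hwv, tangentCoord_tangentOfCoord hs]⟩
    have hinj : Function.Injective (B q) := (LinearMap.injective_iff_surjective
      (f := (B q).toLinearMap)).2 hsurj
    exact ⟨(LinearEquiv.ofBijective (B q).toLinearMap ⟨hinj, hsurj⟩).toContinuousLinearEquiv,
      rfl⟩
  refine ⟨fun q ↦ C q ∘L (B q).inverse, hC.clm_comp ?_, ?_⟩
  -- Inversion of operators is smooth at invertible ones.
  · obtain ⟨e, he⟩ := hinv p₀ hpU (mem_chart_source VM (π p₀))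
    have := contDiffAt_map_inverse (n := (k : WithTop ℕ∞)) e
    rw [he] at this
    exact this.comp_contMDiffAt hB
  · filter_upwards [hU.mem_nhds hpU, hπ.continuous.continuousAt.eventually
      ((chartAt VM (π p₀)).open_source.mem_nhds (mem_chart_source VM (π p₀)))] with q hq hs w hw
    obtain ⟨u, hu1, hu2⟩ := key q hq w hw
    rw [← hu1, ← hu2, ContinuousLinearMap.comp_apply, (hinv q hq hs).inverse_apply_self]

end Coordinates

/-! ### Uniqueness of horizontal lifts, and completeness. -/

section Uniqueness

variable {VM : Type*} [NormedAddCommGroup VM] [NormedSpace ℝ VM] [FiniteDimensional ℝ VM]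
  {VE : Type*} [NormedAddCommGroup VE] [NormedSpace ℝ VE] [FiniteDimensional ℝ VE]
  {M : Type*} [TopologicalSpace M] [ChartedSpace VM M]
  {E : Type*} [TopologicalSpace E] [ChartedSpace VE E]
  {π : E → M} [IsManifold 𝓘(ℝ, VM) 1 M] [IsManifold 𝓘(ℝ, VE) 1 E] {k : ℕ∞}
  {H : ∀ p : E, Submodule ℝ (TangentSpace 𝓘(ℝ, VE) p)}

/-- Uniqueness for linear combinations of Lipschitz vector fields with bounded coefficients. -/
theorem eqOn_Icc_of_hasDerivWithinAt {a b : ℝ} {A : VE → VM →L[ℝ] VE} {K : NNReal} {S : Set VE}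
    (hA : LipschitzOnWith K A S) {g : ℝ → VM} (hg : ContinuousOn g (Icc a b)) {x y : ℝ → VE}
    (hx : ∀ t ∈ Icc a b, HasDerivWithinAt x (A (x t) (g t)) (Icc a b) t)
    (hxS : ∀ t ∈ Icc a b, x t ∈ S)
    (hy : ∀ t ∈ Icc a b, HasDerivWithinAt y (A (y t) (g t)) (Icc a b) t)
    (hyS : ∀ t ∈ Icc a b, y t ∈ S) (h : x a = y a ∨ x b = y b) : EqOn x y (Icc a b) := by
  obtain ⟨B, hB⟩ := isCompact_Icc.exists_bound_of_continuousOn hg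
  have hlip : ∀ t ∈ Icc a b, LipschitzOnWith (K * B.toNNReal) (fun z ↦ A z (g t)) S := by
    intro t ht
    refine LipschitzOnWith.of_dist_le_mul fun z hz z' hz' ↦ ?_
    rw [dist_eq_norm, ← sub_apply, NNReal.coe_mul]
    have hBn : ‖g t‖ ≤ B.toNNReal := (hB t ht).trans (Real.le_coe_toNNReal B)
    calc ‖(A z - A z') (g t)‖ ≤ ‖A z - A z'‖ * ‖g t‖ := (A z - A z').le_opNorm _
      _ ≤ (K * dist z z') * B.toNNReal := by
        gcongr
        rw [← dist_eq_norm]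
        exact hA.dist_le_mul z hz z' hz'
      _ = K * B.toNNReal * dist z z' := by ring
  have hxc : ContinuousOn x (Icc a b) := fun t ht ↦ (hx t ht).continuousWithinAt
  have hyc : ContinuousOn y (Icc a b) := fun t ht ↦ (hy t ht).continuousWithinAt
  rcases h with h | h
  · exact ODE_solution_unique_of_mem_Icc_right (v := fun t z ↦ A z (g t)) (s := fun _ ↦ S)
      (fun t ht ↦ hlip t (Ico_subset_Icc_self ht)) hxc
      (fun t ht ↦ (hx t (Ico_subset_Icc_self ht)).mono_of_mem_nhdsWithin (Icc_mem_nhdsGE_of_mem ht))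
      (fun t ht ↦ hxS t (Ico_subset_Icc_self ht)) hyc
      (fun t ht ↦ (hy t (Ico_subset_Icc_self ht)).mono_of_mem_nhdsWithin (Icc_mem_nhdsGE_of_mem ht))
      (fun t ht ↦ hyS t (Ico_subset_Icc_self ht)) h
  · exact ODE_solution_unique_of_mem_Icc_left (v := fun t z ↦ A z (g t)) (s := fun _ ↦ S)
      (fun t ht ↦ hlip t (Ioc_subset_Icc_self ht)) hxc
      (fun t ht ↦ (hx t (Ioc_subset_Icc_self ht)).mono_of_mem_nhdsWithin (Icc_mem_nhdsLE_of_mem ht))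
      (fun t ht ↦ hxS t (Ioc_subset_Icc_self ht)) hyc
      (fun t ht ↦ (hy t (Ioc_subset_Icc_self ht)).mono_of_mem_nhdsWithin (Icc_mem_nhdsLE_of_mem ht))
      (fun t ht ↦ hyS t (Ioc_subset_Icc_self ht)) h

theorem continuousOn_tangentCoord_velocity {x₀ : M} {γ : ℝ → M} {J : Set ℝ}
    (hγ : ContMDiffOn 𝓘(ℝ, ℝ) 𝓘(ℝ, VM) 1 γ J) (hu : UniqueDiffOn ℝ J)
    (hs : ∀ t ∈ J, γ t ∈ (chartAt VM x₀).source) :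
    ContinuousOn (fun t ↦ tangentCoord x₀ (velocity VM γ J t)) J := by
  have h1 : ContDiffOn ℝ 1 (extChartAt 𝓘(ℝ, VM) x₀ ∘ γ) J :=
    contMDiffOn_iff_contDiffOn.1 ((contMDiffOn_extChartAt (I := 𝓘(ℝ, VM)) (n := 1)).comp hγ hs)
  refine (h1.continuousOn_derivWithin hu le_rfl).congr fun t ht ↦ ?_
  exact ((tangentCoord_velocity (hs t ht) (hγ.mdiffWithinAt ht)).derivWithin (hu t ht)).symm

variable (hH : IsConnection VM VE k π H) (hk : 1 ≤ k)
  (hπ : ContMDiff 𝓘(ℝ, VE) 𝓘(ℝ, VM) (k + 1) π)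
  (hsub : ∀ p : E, Function.Surjective (mfderiv 𝓘(ℝ, VE) 𝓘(ℝ, VM) π p))

include hH hk hπ hsub

/-- Local uniqueness of horizontal lifts. -/
theorem IsConnection.eventually_eq_lift {γ : ℝ → M} {J : Set ℝ} (h : IsPath VM γ J)
    (hJ : J.Nontrivial) {c c' : ℝ → E} (hc : IsHorizontalLift VE π H γ J c)
    (hc' : IsHorizontalLift VE π H γ J c') {t₀ : ℝ} (ht₀ : t₀ ∈ J) (h₀ : c t₀ = c' t₀) :
    ∀ᶠ t in 𝓝[J] t₀, c t = c' t := by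
  obtain ⟨A, hA, hAH⟩ := hH.exists_coord hπ hsub (c t₀)
  have hu := h.ordConnected.uniqueDiffOn_real hJ
  have hπd : MDifferentiable 𝓘(ℝ, VE) 𝓘(ℝ, VM) π := hπ.mdifferentiable (by simp)
  let φ := extChartAt 𝓘(ℝ, VE) (c t₀)
  have hφp : φ.symm (φ (c t₀)) = c t₀ := extChartAt_to_inv _
  obtain ⟨K, S, hS, hlip⟩ : ∃ K, ∃ S ∈ 𝓝 (φ (c t₀)), LipschitzOnWith K (A ∘ φ.symm) S := by
    refine ContDiffAt.exists_lipschitzOnWith (𝕂 := ℝ) ?_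
    have h1 : ContMDiffAt 𝓘(ℝ, VE) 𝓘(ℝ, VE) 1 φ.symm (φ (c t₀)) :=
      (contMDiffOn_extChartAt_symm (c t₀)).contMDiffAt (extChartAt_target_mem_nhds (c t₀))
    have h2 : ContMDiffAt 𝓘(ℝ, VE) 𝓘(ℝ, VM →L[ℝ] VE) 1 A (φ.symm (φ (c t₀))) := by
      rw [hφp]
      exact hA.of_le (by exact_mod_cast hk)
    exact (h2.comp _ h1).contDiffAt
  -- The points near `c t₀` where both charts, the Lipschitz bound and the coordinate formula for
  -- horizontal vectors are available.
  let Q : Set E := {q | (q ∈ (chartAt VE (c t₀)).source ∧ φ q ∈ S ∧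
    π q ∈ (chartAt VM (π (c t₀))).source) ∧ ∀ w ∈ H q, tangentCoord (c t₀) ⟨q, w⟩ =
        A q (tangentCoord (π (c t₀)) ⟨π q, mfderiv 𝓘(ℝ, VE) 𝓘(ℝ, VM) π q w⟩)}
  have hQ : Q ∈ 𝓝 (c t₀) := by
    filter_upwards [(chartAt VE (c t₀)).open_source.mem_nhds (mem_chart_source VE (c t₀)),
      (continuousAt_extChartAt (I := 𝓘(ℝ, VE)) (c t₀)).eventually hS,
      hπ.continuous.continuousAt.eventually ((chartAt VM (π (c t₀))).open_source.mem_nhds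
        (mem_chart_source VM (π (c t₀)))), hAH] with q h1 h2 h3 h4 using ⟨⟨h1, h2, h3⟩, h4⟩
  have hev : ∀ᶠ t in 𝓝[J] t₀, c t ∈ Q ∧ c' t ∈ Q :=
    ((hc.contMDiffOn.continuousOn t₀ ht₀).eventually hQ).and
      ((hc'.contMDiffOn.continuousOn t₀ ht₀).eventually (by rwa [← h₀]))
  -- Agreement at either end is admitted because `t₀` will be the left end for later times and the
  -- right end for earlier ones.
  have key : ∀ a b, a < b → Icc a b ⊆ J → (∀ t ∈ Icc a b, c t ∈ Q ∧ c' t ∈ Q) →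
      (c a = c' a ∨ c b = c' b) → EqOn c c' (Icc a b) := by
    intro a b hab hsubJ hin hend
    -- In the chart every horizontal lift solves the same equation, whose time dependence enters
    -- only through the velocity of `γ`.
    have hder : ∀ d : ℝ → E, IsHorizontalLift VE π H γ J d → (∀ t ∈ Icc a b, d t ∈ Q) →
        ∀ t ∈ Icc a b, HasDerivWithinAt (φ ∘ d) ((A ∘ φ.symm) ((φ ∘ d) t)
          (tangentCoord (π (c t₀)) (velocity VM γ (Icc a b) t))) (Icc a b) t := by
      intro d hd hdQ t ht
      have hdm := hd.contMDiffOn.mdiffWithinAt (hsubJ ht)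
      have h1 := (tangentCoord_velocity (hdQ t ht).1.1 hdm).mono hsubJ
      have h2 : tangentCoord (c t₀) (velocity VE d J t) = A (d t)
          (tangentCoord (π (c t₀)) (velocity VM γ J t)) := by
        rw [velocity_eq_of_proj hd.contMDiffOn hd.proj hπd hu (hsubJ ht)]
        exact (hdQ t ht).2 _ (hd.horizontal t (hsubJ ht))
      have h3 : φ.symm (φ (d t)) = d t :=
        φ.left_inv (by rw [extChartAt_source]; exact (hdQ t ht).1.1)
      rw [velocity_mono hsubJ ht (uniqueDiffOn_Icc hab) (h.contMDiffOn.mdiffWithinAt (hsubJ ht))]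
      simp only [Function.comp, h3]
      rwa [h2] at h1
    have hg : ContinuousOn (fun t ↦ tangentCoord (π (c t₀)) (velocity VM γ (Icc a b) t))
        (Icc a b) :=
      continuousOn_tangentCoord_velocity (h.contMDiffOn.mono hsubJ) (uniqueDiffOn_Icc hab)
        fun t ht ↦ by rw [← hc.proj t (hsubJ ht)]; exact (hin t ht).1.1.2.2
    have heq := eqOn_Icc_of_hasDerivWithinAt hlip hg (hder c hc fun t ht ↦ (hin t ht).1)
      (fun t ht ↦ (hin t ht).1.1.2.1) (hder c' hc' fun t ht ↦ (hin t ht).2)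
      (fun t ht ↦ (hin t ht).2.1.2.1) (hend.imp (congrArg φ) (congrArg φ))
    intro t ht
    refine φ.injOn ?_ ?_ (heq ht)
    · rw [extChartAt_source]; exact (hin t ht).1.1.1
    · rw [extChartAt_source]; exact (hin t ht).2.1.1
  obtain ⟨ε, hε, hball⟩ := Metric.mem_nhdsWithin_iff.1 hev
  refine Metric.mem_nhdsWithin_iff.2 ⟨ε, hε, fun t ht ↦ ?_⟩
  have ht₀' : t₀ ∈ Metric.ball t₀ ε := Metric.mem_ball_self hε
  have hoc : (Metric.ball t₀ ε).OrdConnected := (convex_ball t₀ ε).ordConnected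
  rcases lt_trichotomy t t₀ with hlt | rfl | hlt
  · exact key t t₀ hlt (h.ordConnected.out ht.2 ht₀) (fun s hs ↦ hball
      ⟨hoc.out ht.1 ht₀' hs, h.ordConnected.out ht.2 ht₀ hs⟩) (Or.inr h₀) (left_mem_Icc.2 hlt.le)
  · exact h₀
  · exact key t₀ t hlt (h.ordConnected.out ht₀ ht.2) (fun s hs ↦ hball
      ⟨hoc.out ht₀' ht.1 hs, h.ordConnected.out ht₀ ht.2 hs⟩) (Or.inl h₀) (right_mem_Icc.2 hlt.le)

/-- The set of coincidence is open in `J` by local uniqueness and closed because `E` is Hausdorff,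
while `J` is connected. -/
theorem IsConnection.eqOn_lift [T2Space E] {γ : ℝ → M} {J : Set ℝ} (h : IsPath VM γ J)
    {c c' : ℝ → E} (hc : IsHorizontalLift VE π H γ J c) (hc' : IsHorizontalLift VE π H γ J c')
    {s : ℝ} (hs : s ∈ J) (h₀ : c s = c' s) : EqOn c c' J := by
  rcases J.subsingleton_or_nontrivial with hJ | hJ
  · intro t ht
    rwa [hJ ht hs]
  · have : PreconnectedSpace J := isPreconnected_iff_preconnectedSpace.1
      h.ordConnected.isPreconnected
    have hclopen : IsClopen {t : J | c t = c' t} := by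
      refine ⟨isClosed_eq (continuousOn_iff_continuous_domRestrict.1 hc.contMDiffOn.continuousOn)
        (continuousOn_iff_continuous_domRestrict.1 hc'.contMDiffOn.continuousOn), ?_⟩
      rw [isOpen_iff_mem_nhds]
      rintro ⟨t, ht⟩ hct
      exact (eventually_nhds_subtype_iff J ⟨t, ht⟩ fun t ↦ c t = c' t).2
        (hH.eventually_eq_lift hk hπ hsub h hJ hc hc' ht hct)
    have huniv := hclopen.eq_univ ⟨⟨s, hs⟩, h₀⟩
    intro t ht
    have : (⟨t, ht⟩ : J) ∈ {t : J | c t = c' t} := by rw [huniv]; trivial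
    exact this

/-- The horizontal lifts of a complete connection. -/
theorem IsConnection.isLiftRule [T2Space E] (hcompl : IsCompleteDistribution VM VE π H) :
    IsLiftRule VM VE π (IsHorizontalLift VE π H) where
  proj hc := hc.proj
  congr _ hc e := hc.congr e
  exists_lift h s hs p hp := hcompl _ _ h s hs p hp
  unique h hc hc' _ hs e := hH.eqOn_lift hk hπ hsub h hc hc' hs e
  mono _ hc hJ h' := hc.mono hJ h'.ordConnected
  reparam _ h' hχ hd _ hc := hc.reparam h'.ordConnected hχ.mapsTo hd
  contMDiffOn _ hc := hc.contMDiffOn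

/-- A horizontal vector is determined by its projection, which gives uniqueness of velocities. In
coordinates the lift of `X` at `q` is `A q` applied to `X (π q)`, which is `C^k` in `q`. -/
theorem IsConnection.isRegularLiftRule [T2Space E] (hcompl : IsCompleteDistribution VM VE π H) :
    IsRegularLiftRule VM VE k π (IsHorizontalLift VE π H) where
  __ := hH.isLiftRule hk hπ hsub hcompl
  velocity_unique p v w w' hw hw' := by
    have hΛ := hH.isLiftRule hk hπ hsub hcompl
    have hπd : MDifferentiable 𝓘(ℝ, VE) 𝓘(ℝ, VM) π := hπ.mdifferentiable (by simp)
    exact hH.eq_of_mfderiv_eq hw.mem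
      hw'.mem
      ((hw.mfderiv_eq hΛ hπd).trans (hw'.mfderiv_eq hΛ hπd).symm)
  smooth U X Y hU hX hY := by
    have hΛ := hH.isLiftRule hk hπ hsub hcompl
    have hπd : MDifferentiable 𝓘(ℝ, VE) 𝓘(ℝ, VM) π := hπ.mdifferentiable (by simp)
    intro p hp
    have hnhds : π ⁻¹' U ∈ 𝓝 p := (hU.preimage hπ.continuous).mem_nhds hp
    refine (contMDiffAt_vectorField_iff.2 ?_).contMDiffWithinAt
    obtain ⟨A, hA, hAH⟩ := hH.exists_coord hπ hsub p
    have hXp : ContMDiffAt 𝓘(ℝ, VE) 𝓘(ℝ, VM).tangent k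
        (fun q ↦ (⟨π q, X (π q)⟩ : TangentBundle 𝓘(ℝ, VM) M)) p :=
      (hX.contMDiffAt (hU.mem_nhds hp)).comp p (hπ.contMDiffAt.of_le le_self_add)
    refine (hA.clm_apply hXp.tangentCoord).congr_of_eventuallyEq ?_
    filter_upwards [hAH, hnhds] with q hq hqU
    rw [hq _ (hY q hqU).mem, (hY q hqU).mfderiv_eq hΛ hπd]

theorem IsConnection.ruleVelocity_eq [T2Space E] (hcompl : IsCompleteDistribution VM VE π H)
    (p : E) : {w | ∃ v, RuleVelocity VM VE π (IsHorizontalLift VE π H) p v w} = (H p : Set _) := by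
  ext w
  refine ⟨fun ⟨v, hv⟩ ↦ hv.mem, fun hw ↦ ?_⟩
  have hπd : MDifferentiable 𝓘(ℝ, VE) 𝓘(ℝ, VM) π := hπ.mdifferentiable (by simp)
  have hΛ := hH.isRegularLiftRule hk hπ hsub hcompl
  obtain ⟨w', hw'⟩ := hΛ.exists_ruleVelocity p (mfderiv 𝓘(ℝ, VE) 𝓘(ℝ, VM) π p w)
  refine ⟨mfderiv 𝓘(ℝ, VE) 𝓘(ℝ, VM) π p w, ?_⟩
  have e : w = w' := hH.eq_of_mfderiv_eq hw hw'.mem (hw'.mfderiv_eq hΛ.toIsLiftRule hπd).symm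
  rwa [← e] at hw'

/-- A connection which generates a path mapping is complete. -/
theorem IsConnection.isComplete_of_isGeneratedBy [T2Space E] {P : PathMapping VM π}
    (hP : P.IsGeneratedBy VE H) : IsCompleteDistribution VM VE π H := by
  have hIcc : ∀ (γ : ℝ → M) (a b : ℝ), IsPath VM γ (Icc a b) → ∀ s ∈ Icc a b, ∀ p : E, π p = γ s →
      ∃ c : ℝ → E, IsHorizontalLift VE π H γ (Icc a b) c ∧ c s = p := by
    intro γ a b h s hs p hp
    have hI : IsPath VM γ (Icc a s) := h.Icc_initial hs
    have hd : ContDiffOn ℝ 1 (fun t ↦ a + s - t) (Icc a s) :=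
      (contDiff_const.sub contDiff_id).contDiffOn
    have hI' : IsPath VM (γ ∘ fun t ↦ a + s - t) (Icc a s) :=
      hI.comp_bijOn (bijOn_Icc_sub a s) hd ordConnected_Icc
    have ha : a ∈ Icc a s := left_mem_Icc.2 hs.1
    have hs' : s ∈ Icc a s := right_mem_Icc.2 hs.1
    -- Only lifts from initial points are given, so `p` is first carried back to a point over `γ a`
    -- along the reversed path. The lift starting there passes through `p` by uniqueness.
    obtain ⟨c', hc', hc'a, -⟩ := hP _ a s hI' ⟨p, by simpa using hp⟩
    have hq : π (c' s) = γ a := by simpa using hc'.proj s hs'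
    obtain ⟨c, hc, hca, -⟩ := hP γ a b h ⟨c' s, hq⟩
    refine ⟨c, hc, ?_⟩
    have h1 := (hc.mono (Icc_subset_Icc_right hs.2) ordConnected_Icc).reparam ordConnected_Icc
      (bijOn_Icc_sub a s).mapsTo hd
    have h2 := hH.eqOn_lift hk hπ hsub hI' h1 hc' hs' (by simpa using hca) ha
    simp only [Function.comp, add_sub_cancel_left] at h2
    rw [h2, hc'a]
  intro γ J h s hs p hp
  have hI : ∀ {a b : ℝ}, a ∈ J → b ∈ J → a ≤ b → IsPath VM γ (Icc a b) := fun ha hb hab ↦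
    h.mono (h.ordConnected.out ha hb) (nonempty_Icc.2 hab) ordConnected_Icc
  have hmin : ∀ {x y : ℝ}, x ∈ J → y ∈ J → min x y ∈ J := fun {x y} hx hy ↦ by
    rcases min_choice x y with e | e <;> rwa [e]
  have hmax : ∀ {x y : ℝ}, x ∈ J → y ∈ J → max x y ∈ J := fun {x y} hx hy ↦ by
    rcases max_choice x y with e | e <;> rwa [e]
  have hex : ∀ t ∈ J, ∃ d : ℝ → E,
      IsHorizontalLift VE π H γ (Icc (min s t) (max s t)) d ∧ d s = p := fun t ht ↦
    hIcc γ _ _ (hI (hmin hs ht) (hmax hs ht) min_le_max) s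
      ⟨min_le_left _ _, le_max_left _ _⟩ p hp
  have : Nonempty E := ⟨p⟩
  choose! d hd hds using hex
  -- The lifts `d t` over the intervals between `s` and `t` agree where they overlap, and `c` is
  -- their union.
  let c : ℝ → E := fun t ↦ d t t
  have hc : ∀ a ∈ J, ∀ b ∈ J, s ∈ Icc a b →
      ∃ C, IsHorizontalLift VE π H γ (Icc a b) C ∧ EqOn c C (Icc a b) := by
    intro a ha b hb hsab
    obtain ⟨C, hC, hCs⟩ := hIcc γ a b (hI ha hb (hsab.1.trans hsab.2)) s hsab p hp
    refine ⟨C, hC, fun t ht ↦ ?_⟩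
    have htJ := h.ordConnected.out ha hb ht
    have hsub' : Icc (min s t) (max s t) ⊆ Icc a b :=
      Icc_subset_Icc (le_min hsab.1 ht.1) (max_le hsab.2 ht.2)
    exact hH.eqOn_lift hk hπ hsub (hI (hmin hs htJ) (hmax hs htJ) min_le_max) (hd t htJ)
      (hC.mono hsub' ordConnected_Icc) ⟨min_le_left _ _, le_max_left _ _⟩
      ((hds t htJ).trans hCs.symm) ⟨min_le_right _ _, le_max_right _ _⟩
  have hcC : ContMDiffOn 𝓘(ℝ, ℝ) 𝓘(ℝ, VE) 1 c J := by
    intro t ht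
    obtain ⟨a, ha, b, hb, hsab, htab, hn⟩ := exists_Icc_mem_nhdsWithin hs ht
    obtain ⟨C, hC, e⟩ := hc a ha b hb hsab
    exact ((hC.contMDiffOn.congr e) t htab).mono_of_mem_nhdsWithin hn
  refine ⟨c, ⟨hcC, fun t ht ↦ ?_, fun t ht ↦ ?_⟩, hds s hs⟩
  · exact (hd t ht).proj t ⟨min_le_right _ _, le_max_right _ _⟩
  · rcases J.subsingleton_or_nontrivial with hJ | hJ
    · rw [velocity_snd_eq_zero hJ]
      exact zero_mem _
    -- The extra point `r` makes the compact interval nondegenerate, so the derivative within it is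
    -- the derivative within `J`.
    · obtain ⟨r, hr, hrt⟩ := hJ.exists_ne t
      have hs1 : min (min s t) r ∈ J := hmin (hmin hs ht) hr
      have hs2 : max (max s t) r ∈ J := hmax (hmax hs ht) hr
      have hsI : s ∈ Icc (min (min s t) r) (max (max s t) r) := by simp
      have htI : t ∈ Icc (min (min s t) r) (max (max s t) r) := by simp
      have hrI : r ∈ Icc (min (min s t) r) (max (max s t) r) := by simp
      obtain ⟨C, hC, e⟩ := hc _ hs1 _ hs2 hsI
      have hv : velocity VE c J t = velocity VE C (Icc (min (min s t) r) (max (max s t) r)) t := by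
        rw [← velocity_mono (h.ordConnected.out hs1 hs2) htI
          (ordConnected_Icc.uniqueDiffOn_real ⟨t, htI, r, hrI, hrt.symm⟩)
          (hcC.mdiffWithinAt ht)]
        exact velocity_congr e htI
      exact velocity_mem hv (hC.horizontal t htI)

end Uniqueness

/-! ### The correspondences between transports and connections. -/

section Correspondence

variable {VM : Type*} [NormedAddCommGroup VM] [NormedSpace ℝ VM] [FiniteDimensional ℝ VM]
  {VE : Type*} [NormedAddCommGroup VE] [NormedSpace ℝ VE] [FiniteDimensional ℝ VE]
  {M : Type*} [TopologicalSpace M] [ChartedSpace VM M]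
  {E : Type*} [TopologicalSpace E] [T2Space E] [ChartedSpace VE E]
  {π : E → M} {k : ℕ∞} [IsManifold 𝓘(ℝ, VM) 1 M] [IsManifold 𝓘(ℝ, VM) (k + 1) M]
  [IsManifold 𝓘(ℝ, VE) 1 E] {H : ∀ p : E, Submodule ℝ (TangentSpace 𝓘(ℝ, VE) p)}

theorem TransportAlongPaths.distribution_eq {T : TransportAlongPaths VM π}
    (h : ∀ p, T.liftVelocities VE p = (H p : Set (TangentSpace 𝓘(ℝ, VE) p))) :
    T.distribution VE = H := by
  funext p
  rw [TransportAlongPaths.distribution, h p, Submodule.span_eq]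

theorem PathMapping.distribution_eq {P : PathMapping VM π}
    (h : ∀ p, P.liftVelocities VE p = (H p : Set (TangentSpace 𝓘(ℝ, VE) p))) :
    P.distribution VE = H := by
  funext p
  rw [PathMapping.distribution, h p, Submodule.span_eq]

theorem TransportAlongPaths.IsGeneratedBy.isComplete {T : TransportAlongPaths VM π}
    (hT : T.IsGeneratedBy VE H) : IsCompleteDistribution VM VE π H := by
  intro γ J h s hs p hp
  obtain ⟨c, hc, hcs, -⟩ := hT γ J h s s hs hs ⟨p, hp⟩
  exact ⟨c, hc, hcs⟩

/-- Both are governed by the rule `T.IsLift`, and both sets of velocities are those of the rule. -/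
theorem TransportAlongPaths.IsRegular.distribution_toPathMapping {T : TransportAlongPaths VM π}
    (hT : T.IsRegular VE k) : T.toPathMapping.distribution VE = T.distribution VE := by
  funext p
  rw [PathMapping.distribution, TransportAlongPaths.distribution,
    T.isGovernedBy_isLift.liftVelocities_eq hT.isLiftRule p,
    T.isGovernedBy_isLift.toPathMapping.liftVelocities_eq hT.isRegularLiftRule p]

theorem TransportAlongPaths.IsRegular.isParallelTransport {T : TransportAlongPaths VM π}
    (hT : T.IsRegular VE k) : T.toPathMapping.IsParallelTransport VE k :=
  T.isGovernedBy_isLift.toPathMapping.isParallelTransport hT.isRegularLiftRule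

/-- Every parallel transport comes from a regular transport along paths. -/
theorem PathMapping.IsParallelTransport.exists_transport {P : PathMapping VM π}
    (hP : P.IsParallelTransport VE k) :
    ∃ T : TransportAlongPaths VM π, T.IsRegular VE k ∧ T.toPathMapping = P := by
  obtain ⟨T, hT⟩ := hP.isLiftRule.exists_transport
  exact ⟨T, hT.isRegular hP.isRegularLiftRule,
    PathMapping.IsGovernedBy.unique hP.isLiftRule hT.toPathMapping hP.isGovernedBy⟩

variable (hk : 1 ≤ k) (hπ : ContMDiff 𝓘(ℝ, VE) 𝓘(ℝ, VM) (k + 1) π)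
  (hsub : ∀ p : E, Function.Surjective (mfderiv 𝓘(ℝ, VE) 𝓘(ℝ, VM) π p))

include hk hπ hsub

theorem TransportAlongPaths.IsRegular.liftVelocities_eq {T : TransportAlongPaths VM π}
    (hT : T.IsRegular VE k) (p : E) : T.liftVelocities VE p =
      (hT.isRegularLiftRule.horizontal p : Set (TangentSpace 𝓘(ℝ, VE) p)) := by
  rw [T.isGovernedBy_isLift.liftVelocities_eq hT.isLiftRule p]
  ext w
  exact (hT.isRegularLiftRule.mem_horizontal_iff_ruleVelocity hk (hπ.of_le le_add_self) hsub).symm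

theorem TransportAlongPaths.IsRegular.distribution_eq_horizontal {T : TransportAlongPaths VM π}
    (hT : T.IsRegular VE k) : T.distribution VE = hT.isRegularLiftRule.horizontal :=
  TransportAlongPaths.distribution_eq fun p ↦ hT.liftVelocities_eq hk hπ hsub p

theorem TransportAlongPaths.IsRegular.coe_distribution {T : TransportAlongPaths VM π}
    (hT : T.IsRegular VE k) (p : E) :
    (T.distribution VE p : Set (TangentSpace 𝓘(ℝ, VE) p)) = T.liftVelocities VE p := by
  rw [hT.distribution_eq_horizontal hk hπ hsub, hT.liftVelocities_eq hk hπ hsub]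

theorem TransportAlongPaths.IsRegular.isConnection {T : TransportAlongPaths VM π}
    (hT : T.IsRegular VE k) : IsConnection VM VE k π (T.distribution VE) := by
  rw [hT.distribution_eq_horizontal hk hπ hsub]
  exact hT.isRegularLiftRule.isConnection_horizontal hk (hπ.of_le le_add_self) hsub

theorem TransportAlongPaths.IsRegular.isGeneratedBy {T : TransportAlongPaths VM π}
    (hT : T.IsRegular VE k) : T.IsGeneratedBy VE (T.distribution VE) := by
  intro γ J h s t hs ht p
  obtain ⟨c, hc, hcs, hct⟩ := T.isGovernedBy_isLift γ J h s t hs ht p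
  refine ⟨c, ?_, hcs, hct⟩
  rw [hT.distribution_eq_horizontal hk hπ hsub]
  exact hT.isRegularLiftRule.isHorizontalLift hk (hπ.of_le le_add_self) hsub h hc

theorem IsConnection.isRegular_iff (hH : IsConnection VM VE k π H) (T : TransportAlongPaths VM π) :
    (T.IsRegular VE k ∧ T.distribution VE = H) ↔ T.IsGeneratedBy VE H := by
  constructor
  · rintro ⟨hT, rfl⟩
    exact hT.isGeneratedBy hk hπ hsub
  · intro hT
    -- Generation by `H` already contains the completeness of `H`.
    have hΛ := hH.isRegularLiftRule hk hπ hsub hT.isComplete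
    have hT' : T.IsGovernedBy (IsHorizontalLift VE π H) := hT
    refine ⟨hT'.isRegular hΛ, TransportAlongPaths.distribution_eq fun p ↦ ?_⟩
    rw [hT'.liftVelocities_eq hΛ.toIsLiftRule, hH.ruleVelocity_eq hk hπ hsub hT.isComplete]

/-- Two regular transports with the same distribution are governed by the same horizontal lifts,
hence equal; for a complete connection the transport is built from its horizontal lifts. -/
theorem TransportAlongPaths.bijOn_distribution :
    BijOn (fun T : TransportAlongPaths VM π ↦ T.distribution VE) {T | T.IsRegular VE k}
      {H | IsConnection VM VE k π H ∧ IsCompleteDistribution VM VE π H} := by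
  refine ⟨fun T hT ↦ ⟨hT.isConnection hk hπ hsub, (hT.isGeneratedBy hk hπ hsub).isComplete⟩,
    fun T hT T' hT' e ↦ ?_, fun H ⟨hH, hc⟩ ↦ ?_⟩
  · have h1 := hT.isGeneratedBy hk hπ hsub
    have h2 := hT'.isGeneratedBy hk hπ hsub
    rw [← show T.distribution VE = T'.distribution VE from e] at h2
    exact TransportAlongPaths.IsGovernedBy.unique
      ((hT.isConnection hk hπ hsub).isLiftRule hk hπ hsub h1.isComplete) h1 h2
  · obtain ⟨T, hT⟩ := (hH.isLiftRule hk hπ hsub hc).exists_transport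
    exact ⟨T, (hH.isRegular_iff hk hπ hsub T).2 hT⟩

/-- Injectivity goes through connections: the path mapping has the same distribution as the
transport, and this determines the transport. -/
theorem TransportAlongPaths.bijOn_toPathMapping :
    BijOn (fun T : TransportAlongPaths VM π ↦ T.toPathMapping) {T | T.IsRegular VE k}
      {P | P.IsParallelTransport VE k} := by
  refine ⟨fun T hT ↦ hT.isParallelTransport, fun T hT T' hT' e ↦ ?_, fun P hP ↦
    hP.exists_transport⟩
  refine (TransportAlongPaths.bijOn_distribution hk hπ hsub).injOn hT hT' ?_
  have e' : T.toPathMapping = T'.toPathMapping := e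
  change T.distribution VE = T'.distribution VE
  rw [← hT.distribution_toPathMapping, ← hT'.distribution_toPathMapping, e']

theorem IsConnection.isParallelTransport_iff (hH : IsConnection VM VE k π H)
    (P : PathMapping VM π) :
    (P.IsParallelTransport VE k ∧ P.distribution VE = H) ↔ P.IsGeneratedBy VE H := by
  constructor
  · rintro ⟨hP, rfl⟩
    obtain ⟨T, hT, rfl⟩ := hP.exists_transport
    rw [hT.distribution_toPathMapping]
    exact TransportAlongPaths.IsGovernedBy.toPathMapping (hT.isGeneratedBy hk hπ hsub)
  · intro hP
    have hc := hH.isComplete_of_isGeneratedBy hk hπ hsub hP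
    have hΛ := hH.isRegularLiftRule hk hπ hsub hc
    have hP' : P.IsGovernedBy (IsHorizontalLift VE π H) := hP
    refine ⟨hP'.isParallelTransport hΛ, PathMapping.distribution_eq fun p ↦ ?_⟩
    rw [hP'.liftVelocities_eq hΛ, hH.ruleVelocity_eq hk hπ hsub hc]

theorem PathMapping.IsParallelTransport.coe_distribution {P : PathMapping VM π}
    (hP : P.IsParallelTransport VE k) (p : E) :
    (P.distribution VE p : Set (TangentSpace 𝓘(ℝ, VE) p)) = P.liftVelocities VE p := by
  obtain ⟨T, hT, rfl⟩ := hP.exists_transport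
  rw [hT.distribution_toPathMapping, hT.coe_distribution hk hπ hsub,
    T.isGovernedBy_isLift.liftVelocities_eq hT.isLiftRule p,
    T.isGovernedBy_isLift.toPathMapping.liftVelocities_eq hT.isRegularLiftRule p]

theorem PathMapping.bijOn_distribution :
    BijOn (fun P : PathMapping VM π ↦ P.distribution VE) {P | P.IsParallelTransport VE k}
      {H | IsConnection VM VE k π H ∧ IsCompleteDistribution VM VE π H} := by
  have hT := TransportAlongPaths.bijOn_distribution hk hπ hsub
  refine ⟨fun P hP ↦ ?_, fun P hP P' hP' e ↦ ?_, fun H hH ↦ ?_⟩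
  · obtain ⟨T, h, rfl⟩ := hP.exists_transport
    change T.toPathMapping.distribution VE ∈ _
    rw [h.distribution_toPathMapping]
    exact hT.mapsTo h
  · obtain ⟨T, h, rfl⟩ := hP.exists_transport
    obtain ⟨T', h', rfl⟩ := hP'.exists_transport
    refine congrArg _ (hT.injOn h h' ?_)
    change T.toPathMapping.distribution VE = T'.toPathMapping.distribution VE at e
    rwa [h.distribution_toPathMapping, h'.distribution_toPathMapping] at e
  · obtain ⟨T, h, rfl⟩ := hT.surjOn hH
    exact ⟨T.toPathMapping, h.isParallelTransport, h.distribution_toPathMapping⟩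

end Correspondence

theorem mainTheorem12
    {VM : Type*} [NormedAddCommGroup VM] [NormedSpace ℝ VM] [FiniteDimensional ℝ VM]
    {VE : Type*} [NormedAddCommGroup VE] [NormedSpace ℝ VE] [FiniteDimensional ℝ VE]
    {M : Type*} [TopologicalSpace M] [T2Space M] [ChartedSpace VM M]
    {E : Type*} [TopologicalSpace E] [T2Space E] [ChartedSpace VE E]
    (k : ℕ∞) (hk : 1 ≤ k)
    [IsManifold 𝓘(ℝ, VM) 1 M] [IsManifold 𝓘(ℝ, VM) (k + 1) M]
    [IsManifold 𝓘(ℝ, VE) 1 E] [IsManifold 𝓘(ℝ, VE) (k + 1) E]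
    (π : E → M) (hπ : ContMDiff 𝓘(ℝ, VE) 𝓘(ℝ, VM) (k + 1) π)
    (hsub : ∀ p : E, Function.Surjective (mfderiv 𝓘(ℝ, VE) 𝓘(ℝ, VM) π p)) :
    -- a regular transport along paths defines a connection
    (∀ T : TransportAlongPaths VM π, T.IsRegular VE k →
      (∀ p : E, (T.distribution VE p : Set (TangentSpace 𝓘(ℝ, VE) p)) = T.liftVelocities VE p) ∧
      IsConnection VM VE k π (T.distribution VE)) ∧
    -- transports along paths and connections
    BijOn (fun T : TransportAlongPaths VM π ↦ T.distribution VE)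
      {T | T.IsRegular VE k}
      {H | IsConnection VM VE k π H ∧ IsCompleteDistribution VM VE π H} ∧
    (∀ H, IsConnection VM VE k π H → ∀ T : TransportAlongPaths VM π,
      (T.IsRegular VE k ∧ T.distribution VE = H) ↔ T.IsGeneratedBy VE H) ∧
    -- transports along paths and parallel transports
    BijOn (fun T : TransportAlongPaths VM π ↦ T.toPathMapping)
      {T | T.IsRegular VE k} {P | P.IsParallelTransport VE k} ∧
    (∀ T : TransportAlongPaths VM π, T.IsRegular VE k →
      ∀ (γ : ℝ → M) (J : Set ℝ) (h : IsPath VM γ J) (s t : ℝ) (hs : s ∈ J) (ht : t ∈ J),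
        (∀ h' : IsPath VM γ (Icc s t),
          T.map γ J h s t hs ht = T.toPathMapping.map γ s t h') ∧
        (∀ h' : IsPath VM γ (Icc t s),
          Function.LeftInverse (T.map γ J h s t hs ht) (T.toPathMapping.map γ t s h') ∧
          Function.RightInverse (T.map γ J h s t hs ht) (T.toPathMapping.map γ t s h'))) ∧
    -- parallel transports and connections
    (∀ P : PathMapping VM π, P.IsParallelTransport VE k →
      ∀ p : E, (P.distribution VE p : Set (TangentSpace 𝓘(ℝ, VE) p)) = P.liftVelocities VE p) ∧
    BijOn (fun P : PathMapping VM π ↦ P.distribution VE)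
      {P | P.IsParallelTransport VE k}
      {H | IsConnection VM VE k π H ∧ IsCompleteDistribution VM VE π H} ∧
    (∀ H, IsConnection VM VE k π H → ∀ P : PathMapping VM π,
      (P.IsParallelTransport VE k ∧ P.distribution VE = H) ↔ P.IsGeneratedBy VE H) ∧
    -- the three bijections are compatible
    (∀ T : TransportAlongPaths VM π, T.IsRegular VE k →
      T.toPathMapping.distribution VE = T.distribution VE) ∧
    -- the two systems of axioms characterize the parallel transports generated by connections
    (∀ P : PathMapping VM π,
      (P.IsParallelTransport VE k ↔
        ∃ T : TransportAlongPaths VM π, T.IsRegular VE k ∧ T.toPathMapping = P) ∧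
      (P.IsParallelTransport VE k ↔
        ∃ H, IsConnection VM VE k π H ∧ P.IsGeneratedBy VE H)) := by
  refine ⟨fun T hT ↦ ⟨hT.coe_distribution hk hπ hsub, hT.isConnection hk hπ hsub⟩,
    TransportAlongPaths.bijOn_distribution hk hπ hsub,
    fun H hH T ↦ hH.isRegular_iff hk hπ hsub T,
    TransportAlongPaths.bijOn_toPathMapping hk hπ hsub, fun T hT γ J h s t hs ht ↦ ?_,
    fun P hP ↦ hP.coe_distribution hk hπ hsub, PathMapping.bijOn_distribution hk hπ hsub,
    fun H hH P ↦ hH.isParallelTransport_iff hk hπ hsub P,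
    fun T hT ↦ hT.distribution_toPathMapping, fun P ↦ ⟨⟨fun hP ↦ hP.exists_transport, ?_⟩, ?_⟩⟩
  · refine ⟨fun h' ↦ (hT.locality γ J _ h h' (h.ordConnected.out hs ht) s t _ _).symm,
      fun h' ↦ ?_⟩
    have e : T.toPathMapping.map γ t s h' = T.map γ J h t s ht hs :=
      hT.locality γ J _ h h' (h.ordConnected.out ht hs) t s _ _
    rw [e]
    refine ⟨fun p ↦ ?_, fun p ↦ ?_⟩
    · exact (congrFun (T.map_comp γ J h t s t ht hs ht) p).trans
        (congrFun (T.map_self γ J h t ht) p)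
    · exact (congrFun (T.map_comp γ J h s t s hs ht hs) p).trans
        (congrFun (T.map_self γ J h s hs) p)
  · rintro ⟨T, hT, rfl⟩
    exact hT.isParallelTransport
  · constructor
    · intro hP
      have hH := ((PathMapping.bijOn_distribution hk hπ hsub).mapsTo hP).1
      exact ⟨_, hH, (hH.isParallelTransport_iff hk hπ hsub P).1 ⟨hP, rfl⟩⟩
    · rintro ⟨H, hH, hP⟩
      exact ((hH.isParallelTransport_iff hk hπ hsub P).2 hP).1
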